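/- Let $n\ge 1$ and $0<\lambda<n$. All functions are real valued and Lebesgue measurable on $\mathbb R^n$, and $Q$ always denotes a cube with sides parallel to the coordinate axes. For measurable $f$ put $$Mf(x)=\sup_{Q\ni x}\frac1{|Q|}\int_Q|f|\in[0,\infty],\qquad [M,b]f(x)=M(bf)(x)-b(x)\,Mf(x).$$ For locally integrable $g$ let $\|g\|_*=\sup_Q\frac1{|Q|}\int_Q|g-g_Q|$ with $g_Q=\frac1{|Q|}\int_Q g$, and let $\mathrm{BMO}$ be the set of those $g$ with $\|g\|_*<\infty$. Write $b^+=\max\{b,0\}$ and $b^-=-\min\{b,0\}$. Put $$\|g\|_{L(1+\log^+L),Q}=\inf\Big\{\alpha>0:\frac1{|Q|}\int_Q\frac{|g|}{\alpha}\Big(1+\log^+\frac{|g|}{\alpha}\Big)\le1\Big\},$$ $$\|g\|_{WL(1+\log^+L),Q}=\inf\Big\{\alpha>0:\sup_{t>0}\frac1{|Q|}\,\frac{|\{x\in Q:|g(x)|>\alpha t\}|}{\frac1t\left(1+\log^+\frac1t\right)}\le1\Big\}$$ (with $\inf\emptyset=\infty$), and let $\mathcal M_{L(1+\log^+L),\lambda}$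 and $W\mathcal M_{L(1+\log^+L),\lambda}$ be the sets of measurable $g$ for which, respectively, $$\|g\|_{\mathcal M_{L(1+\log^+L),\lambda}}=\sup_Q|Q|^{\lambda/n}\|g\|_{L(1+\log^+L),Q},\qquad \|g\|_{W\mathcal M_{L(1+\log^+L),\lambda}}=\sup_Q|Q|^{\lambda/n}\|g\|_{WL(1+\log^+L),Q}$$ is finite. Theorem. There is a constant $c>0$, depending only on $n$ and $\lambda$, such that for every $b\in\mathrm{BMO}$ with $b^-\in L_\infty$ and every $f\in\mathcal M_{L(1+\log^+L),\lambda}$ the functions $Mf$ and $M(bf)$ are finite almost everywhere (so that $[M,b]f$ is defined almost everywhere), $[M,b]f$ belongs to $W\mathcal M_{L(1+\log^+L),\lambda}$, and $$\|[M,b]f\|_{W\mathcal M_{L(1+\log^+L),\lambda}}\le c\,\big(\|b^+\|_*+\|b^-\|_{L_\infty}\big)\,\|f\|_{\mathcal M_{L(1+\log^+L),\lambda}}.$$ -/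

import Mathlib

open MeasureTheory
open scoped ENNReal NNReal

namespace ZygmundMorrey

noncomputable section

/-- The (closed) cube in `ℝⁿ` with sides parallel to the coordinate axes, lower corner `a` and
side length `l`. It is used only for `0 < l`. -/
def cube {n : ℕ} (a : Fin n → ℝ) (l : ℝ) : Set (Fin n → ℝ) :=
  Set.Icc a (fun i => a i + l)

/-- The Hardy-Littlewood maximal function
`M f (x) = sup_{Q ∋ x} |Q|⁻¹ ∫_Q |f|`, the supremum being over all cubes containing `x`. -/
def maximal {n : ℕ} (f : (Fin n → ℝ) → ℝ) (x : Fin n → ℝ) : ℝ≥0∞ :=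
  ⨆ (a : Fin n → ℝ) (l : ℝ) (_ : 0 < l) (_ : x ∈ cube a l),
    (volume (cube a l))⁻¹ * ∫⁻ y in cube a l, ‖f y‖ₑ

/-- The commutator `[M,b] f (x) = M(bf)(x) - b(x) Mf(x)`. It is meaningful at the points where
both `M(bf)(x)` and `Mf(x)` are finite. -/
def maximalCommutator {n : ℕ} (b f : (Fin n → ℝ) → ℝ) (x : Fin n → ℝ) : ℝ :=
  (maximal (fun y => b y * f y) x).toReal - b x * (maximal f x).toReal

/-- The seminorm `‖f‖_* = sup_Q |Q|⁻¹ ∫_Q |f - f_Q|`. -/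
def bmoNorm {n : ℕ} (f : (Fin n → ℝ) → ℝ) : ℝ≥0∞ :=
  ⨆ (a : Fin n → ℝ) (l : ℝ) (_ : 0 < l),
    (volume (cube a l))⁻¹ * ∫⁻ y in cube a l, ‖f y - ⨍ z in cube a l, f z‖ₑ

/-- `f ∈ BMO(ℝⁿ)`. -/
def MemBMO {n : ℕ} (f : (Fin n → ℝ) → ℝ) : Prop :=
  LocallyIntegrable f volume ∧ bmoNorm f < ∞

/-- The average `‖g‖_{L(1+log⁺L),Q}`: the infimum of all `α > 0` such that
`|Q|⁻¹ ∫_Q Φ(|g| / α) ≤ 1`, where `Φ(t) = t (1 + log⁺ t)`. -/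
def zygmundAvg {n : ℕ} (g : (Fin n → ℝ) → ℝ) (Q : Set (Fin n → ℝ)) : ℝ≥0∞ :=
  ⨅ (α : ℝ) (_ : 0 < α)
    (_ : (volume Q)⁻¹ *
      ∫⁻ x in Q, ENNReal.ofReal (|g x| / α * (1 + Real.posLog (|g x| / α))) ≤ 1),
    ENNReal.ofReal α

/-- The weak average `‖g‖_{WL(1+log⁺L),Q}`: the infimum of all `α > 0` such that
`sup_{t>0} |Q|⁻¹ |{x ∈ Q : |g(x)| > α t}| / ((1/t) (1 + log⁺ (1/t))) ≤ 1`. -/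
def weakZygmundAvg {n : ℕ} (g : (Fin n → ℝ) → ℝ) (Q : Set (Fin n → ℝ)) : ℝ≥0∞ :=
  ⨅ (α : ℝ) (_ : 0 < α)
    (_ : (⨆ (t : ℝ) (_ : 0 < t),
      (volume Q)⁻¹ * (volume {x ∈ Q | α * t < |g x|} /
        ENNReal.ofReal (1 / t * (1 + Real.posLog (1 / t))))) ≤ 1),
    ENNReal.ofReal α

/-- `‖f‖_{M_{L(1+log⁺L),lam}} = sup_Q |Q|^{lam/n} ‖f‖_{L(1+log⁺L),Q}`. -/
def zygmundMorreyNorm {n : ℕ} (lam : ℝ) (f : (Fin n → ℝ) → ℝ) : ℝ≥0∞ :=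
  ⨆ (a : Fin n → ℝ) (l : ℝ) (_ : 0 < l),
    volume (cube a l) ^ (lam / (n : ℝ)) * zygmundAvg f (cube a l)

/-- `‖f‖_{WM_{L(1+log⁺L),lam}} = sup_Q |Q|^{lam/n} ‖f‖_{WL(1+log⁺L),Q}`. -/
def weakZygmundMorreyNorm {n : ℕ} (lam : ℝ) (f : (Fin n → ℝ) → ℝ) : ℝ≥0∞ :=
  ⨆ (a : Fin n → ℝ) (l : ℝ) (_ : 0 < l),
    volume (cube a l) ^ (lam / (n : ℝ)) * weakZygmundAvg f (cube a l)

/-- The Zygmund-Morrey space: Lebesgue measurable functions of finite norm. -/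
def MemZygmundMorrey {n : ℕ} (lam : ℝ) (f : (Fin n → ℝ) → ℝ) : Prop :=
  AEMeasurable f volume ∧ zygmundMorreyNorm lam f < ∞

/-- The weak Zygmund-Morrey space: Lebesgue measurable functions of finite weak norm. -/
def MemWeakZygmundMorrey {n : ℕ} (lam : ℝ) (f : (Fin n → ℝ) → ℝ) : Prop :=
  AEMeasurable f volume ∧ weakZygmundMorreyNorm lam f < ∞

end

end ZygmundMorrey

open Metric Set Filter
open scoped Topology

namespace ZygmundMorrey

/-! In the sup metric on `Fin n → ℝ` cubes are closed balls, so everything is proved for balls.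
Write b_B for the mean of b over B.

Pointwise, |[M,b]f| is at most C f + 2‖b⁻‖_∞ Mf, where C f(x) = sup over B ∋ x of the mean over B of
|b⁺(x) - b⁺(z)||f(z)| (`abs_maximalCommutator_le`). The weight (1/t)(1 + log⁺(1/t)) is at least 1/t,
so it suffices to prove the stronger estimate |{y ∈ B₀ : F(y) > s}| ≲ K (2ρ)^(-λ) |B₀| / s for every
ball B₀ of radius ρ, with F = Mf and F = C f. For Mf this is Vitali covering on balls of radius at
most ρ; larger balls have too small a mean by the Morrey bound.

For C f (`exists_volume_maximalCommutator_le`) normalise the symbol b to mean oscillation at most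
one, which gives exponential integrability by John-Nirenberg (`exists_john_nirenberg`). Small balls
B are treated through |b(x) - b(z)| ≤ |b(x) - b_B| + |b_B - b(z)|. If the mean of |b_B - b||f| is
large, Young's inequality for exp and t(1 + log⁺ t) makes the Zygmund modular of f large on B, and
Vitali applies; only here is more than integrability of f needed. For |b(x) - b_B| times the mean of
|f|, split at |b(x) - b_B| ~ 2^k: Vitali balls of total volume ≲ 2^k ‖f‖₁ / s capture the relevant
B, and inside each the oscillation exceeds 2^k only on a fraction ≲ 4^(-k), so the sum over k is
geometric.

On a ball of radius r ≥ ρ the mean of b differs from b_{B₀} by O(1 + log(r/ρ)), which the decay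
r^(-λ) absorbs; what remains is |b(x) - b_{B₀}| plus a constant, handled by Chebyshev. -/

/-! ### Balls of the sup metric and Vitali covering -/

theorem volume_closedBall_pos {n : ℕ} (x : Fin n → ℝ) {r : ℝ} (hr : 0 < r) :
    0 < volume (closedBall x r) :=
  measure_closedBall_pos volume x hr

theorem volume_closedBall_ne_top {n : ℕ} (x : Fin n → ℝ) (r : ℝ) :
    volume (closedBall x r) ≠ ∞ :=
  measure_closedBall_lt_top.ne

theorem volume_closedBall_mul {n : ℕ} (x y : Fin n → ℝ) {r k : ℝ} (hr : 0 ≤ r) (hk : 0 ≤ k) :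
    volume (closedBall x (k * r)) = ENNReal.ofReal (k ^ n) * volume (closedBall y r) := by
  rw [Real.volume_pi_closedBall _ hr, Real.volume_pi_closedBall _ (mul_nonneg hk hr),
    ← ENNReal.ofReal_mul (by positivity), Fintype.card_fin]
  congr 1
  ring

/-- Vitali's covering lemma for a family of balls of bounded radii, each of which carries
at least as much mass of `g` as its volume. -/
theorem exists_vitali_cover {n : ℕ} (P : (Fin n → ℝ) → ℝ → Prop) (r₀ : ℝ) (S : Set (Fin n → ℝ))
    (g : (Fin n → ℝ) → ℝ≥0∞)
    (h : ∀ y r, 0 < r → r ≤ r₀ → P y r →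
      closedBall y r ⊆ S ∧ volume (closedBall y r) ≤ ∫⁻ z in closedBall y r, g z) :
    ∃ u : Set ((Fin n → ℝ) × ℝ), u.Countable ∧
      (∀ p ∈ u, 0 < p.2 ∧ p.2 ≤ r₀ ∧ P p.1 p.2) ∧
      (∀ y r, 0 < r → r ≤ r₀ → P y r → ∃ p ∈ u, closedBall y r ⊆ closedBall p.1 (5 * p.2)) ∧
      ∑' p : u, volume (closedBall p.1.1 (5 * p.1.2)) ≤ 5 ^ n * ∫⁻ z in S, g z := by
  obtain ⟨u, hu, hdisj, hcov⟩ := Vitali.exists_disjoint_subfamily_covering_enlargement_closedBall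
    {p : (Fin n → ℝ) × ℝ | 0 < p.2 ∧ p.2 ≤ r₀ ∧ P p.1 p.2} (fun p => p.1) (fun p => p.2) r₀
    (fun p hp => hp.2.1) 5 (by norm_num)
  have hcount : u.Countable := hdisj.countable_of_nonempty_interior fun p hp =>
    ⟨p.1, ball_subset_interior_closedBall (mem_ball_self (hu hp).1)⟩
  refine ⟨u, hcount, fun p hp => hu hp, fun y r hr hr₀ hP => hcov (y, r) ⟨hr, hr₀, hP⟩, ?_⟩
  have h5 : ∀ p : u, volume (closedBall p.1.1 (5 * p.1.2)) ≤
      5 ^ n * ∫⁻ z in closedBall p.1.1 p.1.2, g z := by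
    intro p
    rw [volume_closedBall_mul p.1.1 p.1.1 (hu p.2).1.le (by norm_num),
      ENNReal.ofReal_pow (by norm_num), ENNReal.ofReal_ofNat]
    gcongr
    exact (h _ _ (hu p.2).1 (hu p.2).2.1 (hu p.2).2.2).2
  calc ∑' p : u, volume (closedBall p.1.1 (5 * p.1.2))
      ≤ ∑' p : u, 5 ^ n * ∫⁻ z in closedBall p.1.1 p.1.2, g z := ENNReal.tsum_le_tsum h5
    _ = 5 ^ n * ∑' p : u, ∫⁻ z in closedBall p.1.1 p.1.2, g z := ENNReal.tsum_mul_left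
    _ = 5 ^ n * ∫⁻ z in ⋃ p ∈ u, closedBall p.1 p.2, g z := by
        rw [lintegral_biUnion hcount (fun _ _ => measurableSet_closedBall) hdisj]
    _ ≤ 5 ^ n * ∫⁻ z in S, g z := by
        gcongr
        exact iUnion₂_subset fun p hp => (h _ _ (hu hp).1 (hu hp).2.1 (hu hp).2.2).1

/-- The weak type `(1,1)` estimate behind the maximal function. -/
theorem volume_le_of_forall_exists_ball {n : ℕ} (P : (Fin n → ℝ) → ℝ → Prop) (r₀ : ℝ)
    (S E : Set (Fin n → ℝ)) (g : (Fin n → ℝ) → ℝ≥0∞)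
    (h : ∀ y r, 0 < r → r ≤ r₀ → P y r →
      closedBall y r ⊆ S ∧ volume (closedBall y r) ≤ ∫⁻ z in closedBall y r, g z)
    (hE : ∀ x ∈ E, ∃ y r, 0 < r ∧ r ≤ r₀ ∧ P y r ∧ x ∈ closedBall y r) :
    volume E ≤ 5 ^ n * ∫⁻ z in S, g z := by
  obtain ⟨u, hu, -, hcov, hsum⟩ := exists_vitali_cover P r₀ S g h
  refine le_trans (le_trans (measure_mono ?_)
    (measure_biUnion_le volume hu fun p => closedBall p.1 (5 * p.2))) hsum
  intro x hx
  obtain ⟨y, r, hr, hr₀, hP, hxy⟩ := hE x hx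
  obtain ⟨p, hp, hsub⟩ := hcov y r hr hr₀ hP
  exact mem_biUnion hp (hsub hxy)

/-! ### Mean oscillation and the John-Nirenberg inequality -/

/-- Functions whose mean oscillation over every ball is at most one. -/
def HasUnitOscillation {n : ℕ} (b : (Fin n → ℝ) → ℝ) : Prop :=
  LocallyIntegrable b ∧ ∀ x r, 0 < r →
    ∫⁻ y in closedBall x r, ‖b y - ⨍ z in closedBall x r, b z‖ₑ ≤ volume (closedBall x r)

theorem abs_average_sub_le {n : ℕ} {b : (Fin n → ℝ) → ℝ} {x : Fin n → ℝ} {r a κ : ℝ}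
    (hb : IntegrableOn b (closedBall x r)) (hr : 0 < r) (hκ : 0 ≤ κ)
    (h : ∫⁻ y in closedBall x r, ‖b y - a‖ₑ ≤ ENNReal.ofReal κ * volume (closedBall x r)) :
    |(⨍ z in closedBall x r, b z) - a| ≤ κ := by
  have hpos : 0 < volume.real (closedBall x r) :=
    ENNReal.toReal_pos (volume_closedBall_pos x hr).ne' (volume_closedBall_ne_top x r)
  have hfin := volume_closedBall_ne_top x r
  have h1 : |∫ y in closedBall x r, (b y - a)| ≤ κ * volume.real (closedBall x r) := by
    have h2 := (enorm_integral_le_lintegral_enorm (μ := volume.restrict (closedBall x r))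
      (fun y => b y - a)).trans h
    have h3 := ENNReal.toReal_mono (ENNReal.mul_ne_top ENNReal.ofReal_ne_top hfin) h2
    rwa [toReal_enorm, Real.norm_eq_abs, ENNReal.toReal_mul, ENNReal.toReal_ofReal hκ] at h3
  have h4 : (⨍ z in closedBall x r, b z) - a =
      (volume.real (closedBall x r))⁻¹ * ∫ y in closedBall x r, (b y - a) := by
    rw [setAverage_eq, integral_sub hb (integrableOn_const hfin), setIntegral_const,
      smul_eq_mul, smul_eq_mul, mul_sub, inv_mul_cancel_left₀ hpos.ne']
  rw [h4, abs_mul, abs_of_pos (inv_pos.2 hpos), inv_mul_le_iff₀ hpos, mul_comm]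
  exact h1

theorem HasUnitOscillation.integrableOn {n : ℕ} {b : (Fin n → ℝ) → ℝ}
    (hb : HasUnitOscillation b) (x : Fin n → ℝ) (r : ℝ) : IntegrableOn b (closedBall x r) :=
  hb.1.integrableOn_isCompact (isCompact_closedBall x r)

theorem HasUnitOscillation.aemeasurable {n : ℕ} {b : (Fin n → ℝ) → ℝ}
    (hb : HasUnitOscillation b) : AEMeasurable b :=
  hb.1.aestronglyMeasurable.aemeasurable

/-- The oscillation integral over the small ball is at most the one over the large ball, and the
ratio of volumes is k^n; the centres may differ. -/
theorem HasUnitOscillation.abs_average_sub_average_le {n : ℕ} {b : (Fin n → ℝ) → ℝ}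
    (hb : HasUnitOscillation b) {x y : Fin n → ℝ} {r k : ℝ} (hr : 0 < r) (hk : 0 < k)
    (hsub : closedBall y r ⊆ closedBall x (k * r)) :
    |(⨍ z in closedBall y r, b z) - ⨍ z in closedBall x (k * r), b z| ≤ k ^ n := by
  refine abs_average_sub_le (hb.integrableOn y r) hr (by positivity) ?_
  calc _ ≤ ∫⁻ z in closedBall x (k * r), ‖b z - ⨍ w in closedBall x (k * r), b w‖ₑ :=
        lintegral_mono_set hsub
    _ ≤ volume (closedBall x (k * r)) := hb.2 x _ (by positivity)
    _ = _ := volume_closedBall_mul x y hr.le hk.le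

/-- The oscillation over the double of a ball around the average over the ball. -/
theorem HasUnitOscillation.lintegral_double_le {n : ℕ} {b : (Fin n → ℝ) → ℝ}
    (hb : HasUnitOscillation b) (x : Fin n → ℝ) {r : ℝ} (hr : 0 < r) :
    ∫⁻ y in closedBall x (2 * r), ‖b y - ⨍ z in closedBall x r, b z‖ₑ ≤
      ENNReal.ofReal ((1 + 2 ^ n) * 2 ^ n) * volume (closedBall x r) := by
  have h1 := hb.abs_average_sub_average_le (x := x) (y := x) hr two_pos
    (closedBall_subset_closedBall (by linarith))
  set m := ⨍ z in closedBall x r, b z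
  set m₂ := ⨍ z in closedBall x (2 * r), b z
  calc ∫⁻ y in closedBall x (2 * r), ‖b y - m‖ₑ
      ≤ ∫⁻ y in closedBall x (2 * r), (‖b y - m₂‖ₑ + ENNReal.ofReal (2 ^ n)) := by
        refine lintegral_mono fun y => ?_
        rw [show b y - m = (b y - m₂) + (m₂ - m) by ring]
        refine (enorm_add_le _ _).trans ?_
        gcongr
        rw [Real.enorm_eq_ofReal_abs, abs_sub_comm]
        exact ENNReal.ofReal_le_ofReal h1
    _ = (∫⁻ y in closedBall x (2 * r), ‖b y - m₂‖ₑ) +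
          ENNReal.ofReal (2 ^ n) * volume (closedBall x (2 * r)) := by
        rw [lintegral_add_right _ measurable_const, setLIntegral_const]
    _ ≤ volume (closedBall x (2 * r)) +
          ENNReal.ofReal (2 ^ n) * volume (closedBall x (2 * r)) := by
        gcongr
        exact hb.2 x _ (by positivity)
    _ = _ := by
        rw [volume_closedBall_mul x x hr.le two_pos.le, ENNReal.ofReal_mul (by positivity),
          ENNReal.ofReal_add (by positivity) (by positivity), ENNReal.ofReal_one]
        ring

/-- At almost every point where `g` exceeds `A`, averages of `g` over shrinking balls do. -/
theorem ae_eventually_lt_average {n : ℕ} {g : (Fin n → ℝ) → ℝ} (hg : LocallyIntegrable g)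
    (A : ℝ) {r : ℕ → ℝ} (hr : Tendsto r atTop (𝓝[>] 0)) :
    ∀ᵐ x, A < g x → ∃ k, A < ⨍ y in closedBall x (r k), g y := by
  filter_upwards [IsUnifLocDoublingMeasure.ae_tendsto_average volume hg 1] with x hx hA
  have hpos : ∀ᶠ k in atTop, 0 < r k := hr.eventually self_mem_nhdsWithin
  have h := hx (fun _ => x) r hr (hpos.mono fun k hk => mem_closedBall_self (by linarith))
  exact (h.eventually (lt_mem_nhds hA)).exists

theorem lintegral_eq_ofReal_average_mul {n : ℕ} {g : (Fin n → ℝ) → ℝ} {x : Fin n → ℝ} {r : ℝ}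
    (hg : IntegrableOn g (closedBall x r)) (hr : 0 < r) :
    ∫⁻ y in closedBall x r, ‖g y‖ₑ =
      ENNReal.ofReal (⨍ y in closedBall x r, |g y|) * volume (closedBall x r) := by
  have hpos : 0 < volume.real (closedBall x r) :=
    ENNReal.toReal_pos (volume_closedBall_pos x hr).ne' (volume_closedBall_ne_top x r)
  have h1 := ofReal_integral_norm_eq_lintegral_enorm hg
  simp only [Real.norm_eq_abs] at h1
  rw [← h1, setAverage_eq, smul_eq_mul, ENNReal.ofReal_mul (by positivity),
    ENNReal.ofReal_inv_of_pos hpos, Measure.real,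
    ENNReal.ofReal_toReal (volume_closedBall_ne_top x r), mul_right_comm,
    ENNReal.inv_mul_cancel (volume_closedBall_pos x hr).ne' (volume_closedBall_ne_top x r),
    one_mul]

/-- One step of the stopping time argument of John and Nirenberg. -/
theorem HasUnitOscillation.exists_stopping_balls {n : ℕ} {b : (Fin n → ℝ) → ℝ}
    (hb : HasUnitOscillation b) (x₀ : Fin n → ℝ) {ρ : ℝ} (hρ : 0 < ρ) {A : ℝ}
    (hA : A = 5 ^ n * 4 * ((1 + 2 ^ n) * 2 ^ n)) :
    ∃ u : Set ((Fin n → ℝ) × ℝ), u.Countable ∧ (∀ p ∈ u, 0 < p.2) ∧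
      ∑' p : u, volume (closedBall p.1.1 (5 * p.1.2)) ≤ 4⁻¹ * volume (closedBall x₀ ρ) ∧
      (∀ p ∈ u, |(⨍ z in closedBall p.1 (5 * p.2), b z) - ⨍ z in closedBall x₀ ρ, b z| ≤ A) ∧
      ∀ᵐ x, x ∈ closedBall x₀ ρ \ ⋃ p ∈ u, closedBall p.1 (5 * p.2) →
        |b x - ⨍ z in closedBall x₀ ρ, b z| ≤ A := by
  set m := ⨍ z in closedBall x₀ ρ, b z with hm
  have hA0 : 0 < A := by rw [hA]; positivity
  -- The factor (1 + 2^n) 2^n comes from the oscillation over the doubled ball. In `A` it is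
  -- multiplied by the Vitali loss 5^n and by 4, so that the enlarged stopping balls fill at most a
  -- quarter of the original ball.
  have hAK : (1 + 2 ^ n) * 2 ^ n ≤ A := by
    have h5 : (1 : ℝ) ≤ 5 ^ n := one_le_pow₀ (by norm_num)
    have : (0 : ℝ) ≤ (1 + 2 ^ n) * 2 ^ n := by positivity
    rw [hA]; nlinarith
  have hloc : LocallyIntegrable (fun y => b y - m) := hb.1.sub (locallyIntegrable_const m)
  have hint : ∀ y r, IntegrableOn (fun y => b y - m) (closedBall y r) := fun y r =>
    hloc.integrableOn_isCompact (isCompact_closedBall y r)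
  have hdouble := hb.lintegral_double_le x₀ hρ
  rw [← hm] at hdouble
  -- A stopping ball has mean above `A` while its fivefold enlargement does not: the first condition
  -- bounds the total volume, the second bounds the change of the mean of `b`.
  obtain ⟨u, hu, hpu, hcov, hsum⟩ := exists_vitali_cover
    (fun y r => y ∈ closedBall x₀ ρ ∧ A < (⨍ z in closedBall y r, |b z - m|) ∧
      (⨍ z in closedBall y (5 * r), |b z - m|) ≤ A) ρ (closedBall x₀ (2 * ρ))
    (fun z => (ENNReal.ofReal A)⁻¹ * ‖b z - m‖ₑ) (by
      rintro y r hr hrρ ⟨hy, h1, -⟩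
      refine ⟨closedBall_subset_closedBall' (by
        have := mem_closedBall.1 hy; linarith), ?_⟩
      rw [lintegral_const_mul' _ _ (ENNReal.inv_ne_top.2 (by simpa using hA0)),
        lintegral_eq_ofReal_average_mul (hint y r) hr, ← mul_assoc]
      refine le_mul_of_one_le_left' ?_
      rw [← ENNReal.inv_mul_cancel (a := ENNReal.ofReal A) (by simpa using hA0)
        ENNReal.ofReal_ne_top]
      gcongr)
  refine ⟨u, hu, fun p hp => (hpu p hp).1, ?_, ?_, ?_⟩
  · refine hsum.trans ?_
    rw [lintegral_const_mul' _ _ (ENNReal.inv_ne_top.2 (by simpa using hA0))]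
    calc _ ≤ 5 ^ n * ((ENNReal.ofReal A)⁻¹ *
          (ENNReal.ofReal ((1 + 2 ^ n) * 2 ^ n) * volume (closedBall x₀ ρ))) := by gcongr
      _ = _ := by
        rw [← mul_assoc, ← mul_assoc, ← ENNReal.ofReal_inv_of_pos hA0]
        congr 1
        rw [show (5 : ℝ≥0∞) ^ n = ENNReal.ofReal (5 ^ n) by
          rw [ENNReal.ofReal_pow (by norm_num), ENNReal.ofReal_ofNat],
          ← ENNReal.ofReal_mul (by positivity), ← ENNReal.ofReal_mul (by positivity),
          show (4 : ℝ≥0∞)⁻¹ = ENNReal.ofReal 4⁻¹ by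
            rw [ENNReal.ofReal_inv_of_pos (by norm_num), ENNReal.ofReal_ofNat]]
        congr 1
        rw [hA]
        field_simp
  · intro p hp
    obtain ⟨hr, -, -, -, h5⟩ := hpu p hp
    refine abs_average_sub_le (hb.integrableOn _ _) (by linarith) hA0.le ?_
    rw [lintegral_eq_ofReal_average_mul (hint _ _) (by linarith)]
    gcongr
  -- Radii shrink by exactly the Vitali factor, so that the radius preceding the first bad one is
  -- that of the enlarged ball.
  · have hr : Tendsto (fun k : ℕ => ρ * (5⁻¹ : ℝ) ^ k) atTop (𝓝[>] 0) := by
      refine tendsto_nhdsWithin_iff.2 ⟨?_, Eventually.of_forall fun k => by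
        simp only [mem_Ioi]; positivity⟩
      simpa using (tendsto_pow_atTop_nhds_zero_of_lt_one (r := (5⁻¹ : ℝ)) (by norm_num)
        (by norm_num)).const_mul ρ
    have habs : LocallyIntegrable (fun y => |b y - m|) := fun x => IntegrableAtFilter.norm (hloc x)
    filter_upwards [ae_eventually_lt_average habs A hr] with x hx hxQ
    by_contra! hlt
    classical
    have hex := hx hlt
    have hspec := Nat.find_spec hex
    -- At radius `ρ` the ball still lies in the double of the original one, so its mean is at most
    -- (1 + 2^n) 2^n ≤ A.
    have hk0 : Nat.find hex ≠ 0 := by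
      intro h0
      rw [h0, pow_zero, mul_one] at hspec
      have h1 : ∫⁻ y in closedBall x ρ, ‖b y - m‖ₑ ≤
          ENNReal.ofReal ((1 + 2 ^ n) * 2 ^ n) * volume (closedBall x ρ) := by
        rw [Real.volume_pi_closedBall x hρ.le, ← Real.volume_pi_closedBall x₀ hρ.le]
        refine (lintegral_mono_set (closedBall_subset_closedBall' ?_)).trans hdouble
        have := mem_closedBall.1 hxQ.1
        linarith
      rw [lintegral_eq_ofReal_average_mul (hint x ρ) hρ,
        ENNReal.mul_le_mul_iff_left (volume_closedBall_pos x hρ).ne'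
          (volume_closedBall_ne_top x ρ), ENNReal.ofReal_le_ofReal_iff (by positivity)] at h1
      linarith
    obtain ⟨k, hk⟩ := Nat.exists_eq_succ_of_ne_zero hk0
    have hprev := Nat.find_min hex (m := k) (by omega)
    rw [hk] at hspec
    have hrpos : 0 < ρ * (5⁻¹ : ℝ) ^ (k + 1) := by positivity
    obtain ⟨p, hp, hsub⟩ := hcov x (ρ * (5⁻¹ : ℝ) ^ (k + 1)) hrpos
      (mul_le_of_le_one_right hρ.le (pow_le_one₀ (by norm_num) (by norm_num)))
      ⟨hxQ.1, hspec, by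
        rw [show 5 * (ρ * (5⁻¹ : ℝ) ^ (k + 1)) = ρ * 5⁻¹ ^ k by rw [pow_succ]; ring]
        exact not_lt.1 hprev⟩
    exact hxQ.2 (mem_biUnion hp (hsub (mem_closedBall_self hrpos.le)))

/-- The John-Nirenberg inequality in exponential form. -/
theorem exists_john_nirenberg (n : ℕ) :
    ∃ c : ℝ, 0 < c ∧ ∀ b : (Fin n → ℝ) → ℝ, HasUnitOscillation b → ∀ x r, 0 < r →
      ∫⁻ y in closedBall x r, ENNReal.ofReal (Real.exp (c * |b y - ⨍ z in closedBall x r, b z|)) ≤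
        4 * volume (closedBall x r) := by
  set A : ℝ := 5 ^ n * 4 * ((1 + 2 ^ n) * 2 ^ n) with hA
  have hA0 : 0 < A := by rw [hA]; positivity
  have hc : 0 < Real.log 2 / A := div_pos (Real.log_pos (by norm_num)) hA0
  refine ⟨Real.log 2 / A, hc, fun b hb => ?_⟩
  set c := Real.log 2 / A with hcdef
  have hcA : Real.exp (c * A) = 2 := by
    rw [hcdef, div_mul_cancel₀ _ hA0.ne', Real.exp_log (by norm_num)]
  -- Truncation at `K` makes the supremum `X` of the exponential means finite, which is needed to
  -- absorb X/2 into X; monotone convergence removes it at the end.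
  let F : ℕ → (Fin n → ℝ) → ℝ → (Fin n → ℝ) → ℝ≥0∞ := fun K x r y =>
    ENNReal.ofReal (Real.exp (c * min |b y - ⨍ z in closedBall x r, b z| K))
  have hF : ∀ (K : ℕ) x r, 0 < r →
      ∫⁻ y in closedBall x r, F K x r y ≤ 4 * volume (closedBall x r) := by
    intro K
    set X : ℝ≥0∞ := ⨆ (x : Fin n → ℝ) (r : ℝ) (_ : 0 < r),
      (∫⁻ y in closedBall x r, F K x r y) / volume (closedBall x r) with hX
    have hle : ∀ x r, 0 < r → ∫⁻ y in closedBall x r, F K x r y ≤ X * volume (closedBall x r) := by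
      intro x r hr
      rw [← ENNReal.div_le_iff (volume_closedBall_pos x hr).ne' (volume_closedBall_ne_top x r)]
      exact le_iSup_of_le x (le_iSup_of_le r (le_iSup_of_le hr le_rfl))
    have hXfin : X ≠ ∞ := by
      refine ne_top_of_le_ne_top (ENNReal.ofReal_ne_top (r := Real.exp (c * K)))
        (iSup_le fun x => iSup_le fun r => iSup_le fun hr => ?_)
      rw [ENNReal.div_le_iff (volume_closedBall_pos x hr).ne' (volume_closedBall_ne_top x r),
        ← setLIntegral_const]
      refine lintegral_mono fun y => ENNReal.ofReal_le_ofReal (Real.exp_le_exp.2 ?_)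
      gcongr
      exact min_le_right _ _
    -- Off the stopping balls the exponential is at most exp(cA) = 2. On each enlarged ball,
    -- changing to its own mean costs another factor 2, and these balls fill a quarter of the
    -- volume: 2 · X · 1/4 = X/2.
    have hstep : X ≤ 2 + 2⁻¹ * X := by
      refine iSup_le fun x => iSup_le fun r => iSup_le fun hr => ?_
      rw [ENNReal.div_le_iff (volume_closedBall_pos x hr).ne' (volume_closedBall_ne_top x r)]
      obtain ⟨u, hu, hpos, hsum, hav, hae⟩ := hb.exists_stopping_balls x hr hA
      set U := ⋃ p ∈ u, closedBall p.1 (5 * p.2) with hU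
      have hUm : MeasurableSet U := .biUnion hu fun _ _ => measurableSet_closedBall
      have : Countable u := hu.to_subtype
      have hgood : ∫⁻ y in closedBall x r \ U, F K x r y ≤ 2 * volume (closedBall x r) := by
        calc ∫⁻ y in closedBall x r \ U, F K x r y
            ≤ ∫⁻ y in closedBall x r \ U, 2 := by
              refine setLIntegral_mono_ae measurable_const.aemeasurable ?_
              filter_upwards [hae] with y hy hyU
              rw [← ENNReal.ofReal_ofNat, ← hcA]
              refine ENNReal.ofReal_le_ofReal (Real.exp_le_exp.2 ?_)
              gcongr
              exact (min_le_left _ _).trans (hy hyU)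
          _ ≤ 2 * volume (closedBall x r) := by
              rw [setLIntegral_const]
              gcongr
              exact sdiff_subset
      have hbad : ∫⁻ y in U, F K x r y ≤ 2⁻¹ * X * volume (closedBall x r) := by
        calc ∫⁻ y in U, F K x r y
            ≤ ∑' p : u, ∫⁻ y in closedBall p.1.1 (5 * p.1.2), F K x r y := by
              rw [hU, biUnion_eq_iUnion]
              exact lintegral_iUnion_le _ _
          _ ≤ ∑' p : u, 2 * X * volume (closedBall p.1.1 (5 * p.1.2)) := by
              refine ENNReal.tsum_le_tsum fun p => ?_
              rw [mul_assoc]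
              refine le_trans ?_ (mul_le_mul_right (hle p.1.1 (5 * p.1.2)
                (by have := hpos p.1 p.2; linarith)) 2)
              rw [← lintegral_const_mul' _ _ ENNReal.ofNat_ne_top]
              refine lintegral_mono fun y => ?_
              simp only [F]
              rw [show (2 : ℝ≥0∞) = ENNReal.ofReal (Real.exp (c * A)) by
                rw [hcA, ENNReal.ofReal_ofNat], ← ENNReal.ofReal_mul (Real.exp_pos _).le,
                ← Real.exp_add, ← mul_add]
              refine ENNReal.ofReal_le_ofReal (Real.exp_le_exp.2 ?_)
              gcongr
              have h1 := hav p.1 p.2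
              have h2 := abs_sub_le (b y) (⨍ z in closedBall p.1.1 (5 * p.1.2), b z)
                (⨍ z in closedBall x r, b z)
              rcases le_total |b y - ⨍ z in closedBall p.1.1 (5 * p.1.2), b z| (K : ℝ) with h | h
              · rw [min_eq_left h]
                exact (min_le_left _ _).trans (by linarith)
              · rw [min_eq_right h]
                exact (min_le_right _ _).trans (by linarith)
          _ = 2 * X * ∑' p : u, volume (closedBall p.1.1 (5 * p.1.2)) := ENNReal.tsum_mul_left
          _ ≤ 2 * X * (4⁻¹ * volume (closedBall x r)) := by gcongr
          _ = 2⁻¹ * X * volume (closedBall x r) := by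
              have h24 : (2 : ℝ≥0∞) * 4⁻¹ = 2⁻¹ := by
                rw [show (4 : ℝ≥0∞) = 2 * 2 by norm_num, ENNReal.mul_inv (by simp) (by simp),
                  ← mul_assoc, ENNReal.mul_inv_cancel (by simp) (by simp), one_mul]
              rw [← h24]; ring
      calc ∫⁻ y in closedBall x r, F K x r y
          ≤ ∫⁻ y in (closedBall x r \ U) ∪ U, F K x r y :=
            lintegral_mono_set (by rw [sdiff_union_self]; exact subset_union_left)
        _ ≤ _ := lintegral_union_le _ _ _
        _ ≤ 2 * volume (closedBall x r) + 2⁻¹ * X * volume (closedBall x r) :=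
            add_le_add hgood hbad
        _ = _ := by ring
    have hX4 : X ≤ 4 := by
      clear_value X
      lift X to ℝ≥0 using hXfin
      have h2 : (2 : ℝ≥0∞)⁻¹ = ((2⁻¹ : ℝ≥0) : ℝ≥0∞) := by simp
      rw [h2] at hstep
      have h3 : X ≤ 2 + 2⁻¹ * X := by exact_mod_cast hstep
      have h4 : (X : ℝ) ≤ 2 + 2⁻¹ * X := by exact_mod_cast h3
      have h5 : X ≤ 4 := by
        rw [← NNReal.coe_le_coe]; push_cast; linarith
      exact_mod_cast h5
    exact fun x r hr => (hle x r hr).trans (by gcongr)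
  intro x r hr
  have hmono : ∀ y, Monotone fun K => F K x r y := fun y K L hKL =>
    ENNReal.ofReal_le_ofReal (Real.exp_le_exp.2 (by gcongr))
  have hsup : ∀ y, ENNReal.ofReal (Real.exp (c * |b y - ⨍ z in closedBall x r, b z|)) ≤
      ⨆ K, F K x r y := by
    intro y
    obtain ⟨K, hK⟩ := exists_nat_ge |b y - ⨍ z in closedBall x r, b z|
    refine le_iSup_of_le K ?_
    simp only [F]
    rw [min_eq_left hK]
  have hmeas : ∀ K, AEMeasurable (F K x r) (volume.restrict (closedBall x r)) := by
    intro K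
    have := hb.aemeasurable.restrict (s := closedBall x r)
    simp only [F]
    fun_prop
  calc _ ≤ ∫⁻ y in closedBall x r, ⨆ K, F K x r y := lintegral_mono hsup
    _ = ⨆ K, ∫⁻ y in closedBall x r, F K x r y :=
        lintegral_iSup' hmeas (Eventually.of_forall hmono)
    _ ≤ _ := iSup_le fun K => hF K x r hr

/-- The oscillation of `b` over every ball is exponentially integrable at rate `c`. -/
def HasExpOscillation {n : ℕ} (c : ℝ) (b : (Fin n → ℝ) → ℝ) : Prop :=
  ∀ x r, 0 < r →
    ∫⁻ y in closedBall x r, ENNReal.ofReal (Real.exp (c * |b y - ⨍ z in closedBall x r, b z|)) ≤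
      4 * volume (closedBall x r)

/-! ### The Young function and its dual exponential -/

/-- The Young function of `L(1 + log⁺ L)`. -/
noncomputable def zygmundFun (t : ℝ) : ℝ := t * (1 + Real.posLog t)

theorem le_zygmundFun {t : ℝ} (ht : 0 ≤ t) : t ≤ zygmundFun t :=
  le_mul_of_one_le_right ht (by linarith [Real.posLog_nonneg (x := t)])

theorem zygmundFun_nonneg {t : ℝ} (ht : 0 ≤ t) : 0 ≤ zygmundFun t :=
  ht.trans (le_zygmundFun ht)

theorem zygmundFun_mono {s t : ℝ} (hs : 0 ≤ s) (hst : s ≤ t) : zygmundFun s ≤ zygmundFun t := by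
  have := Real.posLog_le_posLog hs hst
  have := Real.posLog_nonneg (x := s)
  have := hs.trans hst
  unfold zygmundFun
  gcongr

/-- Sublinearity under contractions turns the modular bound at the Morrey level into decay
proportional to 1/s at higher levels. -/
theorem zygmundFun_mul_le {k t : ℝ} (hk : 0 ≤ k) (hk1 : k ≤ 1) (ht : 0 ≤ t) :
    zygmundFun (k * t) ≤ k * zygmundFun t := by
  have := Real.posLog_le_posLog (mul_nonneg hk ht) (mul_le_of_le_one_left ht hk1)
  unfold zygmundFun
  rw [mul_assoc]
  gcongr

/-- Young's inequality for the pair `exp`, `L(1 + log⁺ L)`. -/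
theorem mul_le_exp_add_zygmundFun (u : ℝ) {v : ℝ} (hv : 0 ≤ v) :
    u * v ≤ Real.exp u + zygmundFun v := by
  rcases hv.eq_or_lt with rfl | hv
  · simp [zygmundFun, (Real.exp_pos u).le]
  have h1 : v * (u - Real.log v) ≤ Real.exp u := by
    have h2 : v * Real.exp (u - Real.log v) = Real.exp u := by
      rw [Real.exp_sub, Real.exp_log hv]; field_simp
    rw [← h2]
    gcongr
    linarith [Real.add_one_le_exp (u - Real.log v)]
  have h3 : v * Real.log v ≤ v * Real.posLog v := by
    gcongr
    exact le_max_right _ _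
  unfold zygmundFun
  nlinarith

theorem sq_le_exp_div {c u : ℝ} (hc : 0 < c) (hu : 0 ≤ u) :
    u ^ 2 ≤ 2 / c ^ 2 * Real.exp (c * u) := by
  have h := Real.quadratic_le_exp_of_nonneg (mul_nonneg hc.le hu)
  have h2 : (c * u) ^ 2 ≤ 2 * Real.exp (c * u) := by nlinarith [mul_nonneg hc.le hu]
  rw [div_mul_eq_mul_div, le_div_iff₀ (by positivity)]
  linarith [mul_pow c u 2]

/-! ### Weak type bounds for oscillations over small balls -/

theorem volume_ge_le_lintegral {n : ℕ} {T : Set (Fin n → ℝ)} (hT : MeasurableSet T)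
    {g : (Fin n → ℝ) → ℝ≥0∞} (hg : AEMeasurable g) :
    volume {x ∈ T | 1 ≤ g x} ≤ ∫⁻ x in T, g x := by
  have h := mul_meas_ge_le_lintegral₀ (hg.restrict (s := T)) 1
  rw [one_mul, Measure.restrict_apply' hT] at h
  refine le_trans (measure_mono ?_) h
  exact fun x hx => ⟨hx.2, hx.1⟩

/-- The mean oscillations over all balls inside a given ball are in weak `L²`. -/
theorem HasUnitOscillation.volume_oscillation_le {n : ℕ} {b : (Fin n → ℝ) → ℝ} {c : ℝ}
    (hb : HasUnitOscillation b) (hc : 0 < c) (hbc : HasExpOscillation c b)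
    (x₀ : Fin n → ℝ) {R : ℝ} (hR : 0 < R) (r₀ : ℝ) {τ : ℝ} (hτ : 0 < τ) :
    volume {x | ∃ y r, 0 < r ∧ r ≤ r₀ ∧ x ∈ closedBall y r ∧ closedBall y r ⊆ closedBall x₀ R ∧
      τ ≤ |b x - ⨍ z in closedBall y r, b z|} ≤
    ENNReal.ofReal ((1 + 5 ^ n) * (32 / c ^ 2) / τ ^ 2) * volume (closedBall x₀ R) := by
  set m := ⨍ z in closedBall x₀ R, b z with hm
  -- An integrable majorant of 4|b - m|²/τ². Either `x` has |b x - m| ≥ τ/2, hence g x ≥ 1, or the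
  -- mean over the small ball deviates from `m` by more than τ/2, which forces the mean of `g` over
  -- that ball to be at least 1.
  set g : (Fin n → ℝ) → ℝ≥0∞ := fun y =>
    ENNReal.ofReal (8 / c ^ 2 / τ ^ 2) * ENNReal.ofReal (Real.exp (c * |b y - m|)) with hg
  have hgsq : ∀ y, ENNReal.ofReal (4 / τ ^ 2 * |b y - m| ^ 2) ≤ g y := by
    intro y
    rw [hg]
    dsimp only
    rw [← ENNReal.ofReal_mul (by positivity)]
    refine ENNReal.ofReal_le_ofReal ?_
    calc 4 / τ ^ 2 * |b y - m| ^ 2 ≤ 4 / τ ^ 2 * (2 / c ^ 2 * Real.exp (c * |b y - m|)) := by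
          gcongr
          exact sq_le_exp_div hc (abs_nonneg _)
      _ = _ := by ring
  have hgmeas : AEMeasurable g := by
    have := hb.aemeasurable
    rw [hg]
    fun_prop
  have hgint : ∫⁻ y in closedBall x₀ R, g y ≤
      ENNReal.ofReal (32 / c ^ 2 / τ ^ 2) * volume (closedBall x₀ R) := by
    rw [hg, lintegral_const_mul' _ _ ENNReal.ofReal_ne_top]
    refine (mul_le_mul_right (hbc x₀ R hR) _).trans ?_
    rw [← mul_assoc, ← ENNReal.ofReal_ofNat, ← ENNReal.ofReal_mul (by positivity)]
    gcongr
    linarith [show 8 / c ^ 2 / τ ^ 2 * 4 = 32 / c ^ 2 / τ ^ 2 by ring]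
  have h1 : volume {x ∈ closedBall x₀ R | 1 ≤ g x} ≤ ∫⁻ y in closedBall x₀ R, g y :=
    volume_ge_le_lintegral measurableSet_closedBall hgmeas
  have h2 := volume_le_of_forall_exists_ball
    (fun y r => closedBall y r ⊆ closedBall x₀ R ∧ τ / 2 < |(⨍ z in closedBall y r, b z) - m|) r₀
    (closedBall x₀ R) {x | ∃ y r, 0 < r ∧ r ≤ r₀ ∧ (closedBall y r ⊆ closedBall x₀ R ∧
      τ / 2 < |(⨍ z in closedBall y r, b z) - m|) ∧ x ∈ closedBall y r} g (by
      rintro y r hr - ⟨hsub, hlt⟩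
      refine ⟨hsub, ?_⟩
      by_contra! hcon
      refine hlt.not_ge (abs_average_sub_le (hb.integrableOn y r) hr (by positivity) ?_)
      calc ∫⁻ z in closedBall y r, ‖b z - m‖ₑ
          ≤ ∫⁻ z in closedBall y r, (ENNReal.ofReal (τ / 4) + ENNReal.ofReal (τ / 4) * g z) := by
            refine lintegral_mono fun z => ?_
            refine le_trans ?_ (add_le_add_right (mul_le_mul_right (hgsq z) _) _)
            rw [← ENNReal.ofReal_mul (by positivity),
              ← ENNReal.ofReal_add (by positivity) (by positivity), Real.enorm_eq_ofReal_abs]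
            refine ENNReal.ofReal_le_ofReal ?_
            -- Completing the square gives |u| ≤ τ/4 + u²/τ, an elementary substitute for
            -- Cauchy-Schwarz.
            have h4 : τ / 4 + τ / 4 * (4 / τ ^ 2 * |b z - m| ^ 2) - |b z - m| =
                (τ / 2 - |b z - m|) ^ 2 / τ := by field_simp; ring
            have h5 : 0 ≤ (τ / 2 - |b z - m|) ^ 2 / τ := by positivity
            linarith
        _ = ENNReal.ofReal (τ / 4) * volume (closedBall y r) +
              ENNReal.ofReal (τ / 4) * ∫⁻ z in closedBall y r, g z := by
            rw [lintegral_add_left measurable_const, setLIntegral_const,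
              lintegral_const_mul' _ _ ENNReal.ofReal_ne_top]
        _ ≤ ENNReal.ofReal (τ / 4) * volume (closedBall y r) +
              ENNReal.ofReal (τ / 4) * volume (closedBall y r) := by gcongr
        _ = _ := by
            rw [← add_mul, ← ENNReal.ofReal_add (by positivity) (by positivity)]
            congr 2
            ring) (fun x hx => hx)
  refine le_trans (measure_mono (t := {x ∈ closedBall x₀ R | 1 ≤ g x} ∪ _) ?_)
    ((measure_union_le _ _).trans ((add_le_add h1 h2).trans ?_))
  · rintro x ⟨y, r, hr, hr₀, hx, hsub, hle⟩
    by_cases hbig : τ / 2 ≤ |b x - m|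
    · refine Or.inl ⟨hsub hx, le_trans ?_ (hgsq x)⟩
      rw [← ENNReal.ofReal_one]
      refine ENNReal.ofReal_le_ofReal ?_
      rw [div_mul_eq_mul_div, le_div_iff₀ (by positivity)]
      nlinarith
    · refine Or.inr ⟨y, r, hr, hr₀, ⟨hsub, ?_⟩, hx⟩
      have := abs_sub_le (b x) m (⨍ z in closedBall y r, b z)
      rw [abs_sub_comm m] at this
      linarith
  · calc _ ≤ (1 + 5 ^ n) * (ENNReal.ofReal (32 / c ^ 2 / τ ^ 2) * volume (closedBall x₀ R)) := by
          rw [add_mul, one_mul]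
          gcongr
      _ = _ := by
          rw [← mul_assoc, show (1 + 5 ^ n : ℝ≥0∞) = ENNReal.ofReal (1 + 5 ^ n) by
            rw [ENNReal.ofReal_add (by norm_num) (by positivity), ENNReal.ofReal_pow (by norm_num),
              ENNReal.ofReal_ofNat, ENNReal.ofReal_one], ← ENNReal.ofReal_mul (by positivity)]
          congr 2
          ring

/-- Weak type estimate for the supremum of `|b x - b_B| h_B` over small balls `B` around `x`. -/
theorem HasUnitOscillation.volume_oscillation_mul_le {n : ℕ} {b : (Fin n → ℝ) → ℝ} {c : ℝ}
    (hb : HasUnitOscillation b) (hc : 0 < c) (hbc : HasExpOscillation c b)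
    (S : Set (Fin n → ℝ)) (r₀ : ℝ) (h : (Fin n → ℝ) → ℝ≥0∞) :
    volume {x | ∃ y r, 0 < r ∧ r ≤ r₀ ∧ x ∈ closedBall y r ∧ closedBall y r ⊆ S ∧
      volume (closedBall y r) <
        ‖b x - ⨍ z in closedBall y r, b z‖ₑ * ∫⁻ z in closedBall y r, h z} ≤
    ENNReal.ofReal (5 ^ n * (1 + 4 * ((1 + 5 ^ n) * (32 / c ^ 2)))) * ∫⁻ z in S, h z := by
  set C := (1 + 5 ^ n) * (32 / c ^ 2) with hC
  have hC0 : 0 ≤ C := by rw [hC]; positivity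
  -- The layer 2^k ≤ |b x - b_B| ≤ 2^(k+1). Vitali costs 2^(k+1) in total volume and the weak L²
  -- bound gains 4^(-k), leaving the summable 2^(-k).
  set E : ℕ → Set (Fin n → ℝ) := fun k => {x | ∃ y r, 0 < r ∧ r ≤ r₀ ∧ x ∈ closedBall y r ∧
    (closedBall y r ⊆ S ∧ volume (closedBall y r) ≤ ∫⁻ z in closedBall y r, 2 ^ (k + 1) * h z) ∧
      2 ^ k ≤ |b x - ⨍ z in closedBall y r, b z|} with hE
  have h1 := volume_le_of_forall_exists_ball
    (fun y r => closedBall y r ⊆ S ∧ volume (closedBall y r) ≤ ∫⁻ z in closedBall y r, h z) r₀ S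
    {x | ∃ y r, 0 < r ∧ r ≤ r₀ ∧ (closedBall y r ⊆ S ∧
      volume (closedBall y r) ≤ ∫⁻ z in closedBall y r, h z) ∧ x ∈ closedBall y r} h
    (fun y r _ _ hP => hP) (fun x hx => hx)
  have h2 : ∀ k, volume (E k) ≤ ENNReal.ofReal (5 ^ n * (2 * C)) * (∫⁻ z in S, h z) * 2⁻¹ ^ k := by
    intro k
    obtain ⟨u, hu, hpu, hcov, hsum⟩ := exists_vitali_cover
      (fun y r => closedBall y r ⊆ S ∧
        volume (closedBall y r) ≤ ∫⁻ z in closedBall y r, 2 ^ (k + 1) * h z) r₀ S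
      (fun z => 2 ^ (k + 1) * h z) (fun y r _ _ hP => hP)
    rw [lintegral_const_mul' _ _ (by simp)] at hsum
    calc volume (E k)
        ≤ ∑' p : u, volume {x | ∃ y r, 0 < r ∧ r ≤ r₀ ∧ x ∈ closedBall y r ∧
            closedBall y r ⊆ closedBall p.1.1 (5 * p.1.2) ∧
            2 ^ k ≤ |b x - ⨍ z in closedBall y r, b z|} := by
          refine le_trans (measure_mono ?_) (measure_biUnion_le volume hu
            fun p => {x | ∃ y r, 0 < r ∧ r ≤ r₀ ∧ x ∈ closedBall y r ∧
              closedBall y r ⊆ closedBall p.1 (5 * p.2) ∧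
              2 ^ k ≤ |b x - ⨍ z in closedBall y r, b z|})
          rintro x ⟨y, r, hr, hr₀, hx, hP, hle⟩
          obtain ⟨p, hp, hsub⟩ := hcov y r hr hr₀ hP
          exact mem_biUnion hp ⟨y, r, hr, hr₀, hx, hsub, hle⟩
      _ ≤ ∑' p : u, ENNReal.ofReal (C / (2 ^ k) ^ 2) *
            volume (closedBall p.1.1 (5 * p.1.2)) := by
          refine ENNReal.tsum_le_tsum fun p => ?_
          exact hb.volume_oscillation_le hc hbc _ (by have := (hpu p.1 p.2).1; linarith) r₀
            (by positivity)
      _ = ENNReal.ofReal (C / (2 ^ k) ^ 2) *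
            ∑' p : u, volume (closedBall p.1.1 (5 * p.1.2)) := ENNReal.tsum_mul_left
      _ ≤ ENNReal.ofReal (C / (2 ^ k) ^ 2) * (5 ^ n * (2 ^ (k + 1) * ∫⁻ z in S, h z)) := by
          gcongr
      _ = _ := by
          rw [mul_right_comm, ← mul_assoc, ← mul_assoc]
          congr 1
          rw [show (5 : ℝ≥0∞) ^ n = ENNReal.ofReal (5 ^ n) by
            rw [ENNReal.ofReal_pow (by norm_num), ENNReal.ofReal_ofNat],
            show (2 : ℝ≥0∞) ^ (k + 1) = ENNReal.ofReal (2 ^ (k + 1)) by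
            rw [ENNReal.ofReal_pow (by norm_num), ENNReal.ofReal_ofNat],
            show (2⁻¹ : ℝ≥0∞) ^ k = ENNReal.ofReal (2⁻¹ ^ k) by
            rw [ENNReal.ofReal_pow (by norm_num), ENNReal.ofReal_inv_of_pos (by norm_num),
              ENNReal.ofReal_ofNat],
            ← ENNReal.ofReal_mul (by positivity), ← ENNReal.ofReal_mul (by positivity),
            ← ENNReal.ofReal_mul (by positivity)]
          congr 1
          rw [pow_succ (2 : ℝ) k, inv_pow]
          field_simp
  have h3 : volume (⋃ k, E k) ≤ ENNReal.ofReal (5 ^ n * (2 * C)) * (∫⁻ z in S, h z) * 2 := by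
    refine (measure_iUnion_le _).trans ((ENNReal.tsum_le_tsum h2).trans ?_)
    rw [ENNReal.tsum_mul_left, ENNReal.tsum_geometric, ENNReal.one_sub_inv_two, inv_inv]
  refine le_trans (measure_mono (t := _ ∪ ⋃ k, E k) ?_)
    ((measure_union_le _ _).trans ((add_le_add h1 h3).trans ?_))
  · rintro x ⟨y, r, hr, hr₀, hx, hsub, hlt⟩
    -- Oscillation at most 1 reduces to the plain weak (1,1) bound, so layers are needed only for k
    -- ≥ 0.
    by_cases hone : |b x - ⨍ z in closedBall y r, b z| ≤ 1
    · refine Or.inl ⟨y, r, hr, hr₀, ⟨hsub, hlt.le.trans ?_⟩, hx⟩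
      refine mul_le_of_le_one_left' ?_
      rw [Real.enorm_eq_ofReal_abs]
      exact ENNReal.ofReal_le_one.2 hone
    · obtain ⟨k, hk, hk'⟩ := exists_nat_pow_near (not_le.1 hone).le one_lt_two
      refine Or.inr (mem_iUnion.2 ⟨k, y, r, hr, hr₀, hx, ⟨hsub, hlt.le.trans ?_⟩, hk⟩)
      rw [lintegral_const_mul' _ _ (by simp), Real.enorm_eq_ofReal_abs]
      gcongr
      refine (ENNReal.ofReal_le_ofReal hk'.le).trans ?_
      rw [ENNReal.ofReal_pow (by norm_num), ENNReal.ofReal_ofNat]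
  · rw [show (5 : ℝ≥0∞) ^ n = ENNReal.ofReal (5 ^ n) by
      rw [ENNReal.ofReal_pow (by norm_num), ENNReal.ofReal_ofNat], mul_right_comm, ← add_mul]
    gcongr
    rw [← ENNReal.ofReal_ofNat, ← ENNReal.ofReal_mul (by positivity),
      ← ENNReal.ofReal_add (by positivity) (by positivity)]
    refine ENNReal.ofReal_le_ofReal (le_of_eq ?_)
    ring

/-! ### Pairing oscillations with the Zygmund modular, and comparing means -/

/-- Young's inequality applied to c|b - b_B| and `t`: the exponential part contributes 4 volumes and
the modular part 1, whence the 5. -/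
theorem HasExpOscillation.lintegral_mul_le {n : ℕ} {b : (Fin n → ℝ) → ℝ} {c : ℝ}
    (hb : HasUnitOscillation b) (hc : 0 < c) (hbc : HasExpOscillation c b)
    {t : (Fin n → ℝ) → ℝ} (ht : ∀ z, 0 ≤ t z) {y : Fin n → ℝ} {r : ℝ} (hr : 0 < r)
    (hle : ∫⁻ z in closedBall y r, ENNReal.ofReal (zygmundFun (t z)) ≤ volume (closedBall y r)) :
    ∫⁻ z in closedBall y r, ‖b z - ⨍ w in closedBall y r, b w‖ₑ * ENNReal.ofReal (t z) ≤
      ENNReal.ofReal (5 / c) * volume (closedBall y r) := by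
  set m := ⨍ w in closedBall y r, b w
  have hmeas : AEMeasurable (fun z => ENNReal.ofReal (Real.exp (c * |b z - m|)))
      (volume.restrict (closedBall y r)) := by
    have := hb.aemeasurable.restrict (s := closedBall y r)
    fun_prop
  calc _ ≤ ∫⁻ z in closedBall y r, ENNReal.ofReal c⁻¹ *
        (ENNReal.ofReal (Real.exp (c * |b z - m|)) + ENNReal.ofReal (zygmundFun (t z))) := by
        refine lintegral_mono fun z => ?_
        have h := mul_le_exp_add_zygmundFun (c * |b z - m|) (ht z)
        have h0 := zygmundFun_nonneg (ht z)
        rw [Real.enorm_eq_ofReal_abs, ← ENNReal.ofReal_mul (abs_nonneg _),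
          ← ENNReal.ofReal_add (Real.exp_pos _).le h0, ← ENNReal.ofReal_mul (by positivity)]
        refine ENNReal.ofReal_le_ofReal ?_
        rw [le_inv_mul_iff₀ hc]
        linarith
    _ = ENNReal.ofReal c⁻¹ * ((∫⁻ z in closedBall y r, ENNReal.ofReal (Real.exp (c * |b z - m|))) +
          ∫⁻ z in closedBall y r, ENNReal.ofReal (zygmundFun (t z))) := by
        rw [lintegral_const_mul' _ _ ENNReal.ofReal_ne_top, lintegral_add_left' hmeas]
    _ ≤ ENNReal.ofReal c⁻¹ * (4 * volume (closedBall y r) + volume (closedBall y r)) := by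
        gcongr
        exact hbc y r hr
    _ = _ := by
        rw [show 4 * volume (closedBall y r) + volume (closedBall y r) =
          ENNReal.ofReal 5 * volume (closedBall y r) by
            rw [ENNReal.ofReal_ofNat]; ring, ← mul_assoc, ← ENNReal.ofReal_mul (by positivity)]
        congr 2
        ring

/-- Means over a ball and over a larger ball meeting it differ at most logarithmically. -/
theorem HasExpOscillation.abs_average_sub_average_le {n : ℕ} {b : (Fin n → ℝ) → ℝ} {c : ℝ}
    (hb : HasUnitOscillation b) (hc : 0 < c) (hbc : HasExpOscillation c b)
    {x₀ y : Fin n → ℝ} {ρ r : ℝ} (hρ : 0 < ρ) (hr : ρ ≤ r)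
    (hmeet : (closedBall x₀ ρ ∩ closedBall y r).Nonempty) :
    |(⨍ z in closedBall x₀ ρ, b z) - ⨍ z in closedBall y r, b z| ≤
      3 ^ n + (1 + Real.log 4 + n * Real.log (3 * r / ρ)) / c := by
  have hr0 : 0 < r := hρ.trans_le hr
  set m := ⨍ z in closedBall y (3 * r), b z with hm
  have h1 : |(⨍ z in closedBall y r, b z) - m| ≤ 3 ^ n :=
    hb.abs_average_sub_average_le hr0 three_pos (closedBall_subset_closedBall (by linarith))
  have hsub : closedBall x₀ ρ ⊆ closedBall y (3 * r) := by
    obtain ⟨x, hx, hy⟩ := hmeet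
    refine closedBall_subset_closedBall' ?_
    rw [mem_closedBall'] at hx
    rw [mem_closedBall] at hy
    have := dist_triangle x₀ x y
    linarith
  -- exp L = 4 (3r/ρ)^n bounds the mean of exp(c|b - m|) over the small ball. The tangent-line bound
  -- u ≤ L - 1 + exp(u - L) then plays the role of Jensen's inequality.
  set L := Real.log 4 + n * Real.log (3 * r / ρ) with hL
  have hq : 1 ≤ 3 * r / ρ := by rw [le_div_iff₀ hρ]; linarith
  have hL0 : 0 ≤ L := add_nonneg (Real.log_nonneg (by norm_num))
    (mul_nonneg (Nat.cast_nonneg n) (Real.log_nonneg hq))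
  have hexpL : Real.exp L = 4 * (3 * r / ρ) ^ n := by
    rw [hL, Real.exp_add, Real.exp_log (by norm_num), Real.exp_nat_mul,
      Real.exp_log (by linarith)]
  have h2 : |(⨍ z in closedBall x₀ ρ, b z) - m| ≤ (L + 1) / c := by
    refine abs_average_sub_le (hb.integrableOn _ _) hρ (by positivity) ?_
    calc ∫⁻ z in closedBall x₀ ρ, ‖b z - m‖ₑ
        ≤ ∫⁻ z in closedBall x₀ ρ, (ENNReal.ofReal (L / c) + ENNReal.ofReal (Real.exp (-L) / c) *
            ENNReal.ofReal (Real.exp (c * |b z - m|))) := by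
          refine lintegral_mono fun z => ?_
          rw [Real.enorm_eq_ofReal_abs, ← ENNReal.ofReal_mul (by positivity),
            ← ENNReal.ofReal_add (by positivity) (by positivity)]
          refine ENNReal.ofReal_le_ofReal ?_
          rw [div_mul_eq_mul_div, ← add_div, le_div_iff₀ hc, ← Real.exp_add]
          have := Real.add_one_le_exp (-L + c * |b z - m|)
          linarith
      _ = ENNReal.ofReal (L / c) * volume (closedBall x₀ ρ) + ENNReal.ofReal (Real.exp (-L) / c) *
            ∫⁻ z in closedBall x₀ ρ, ENNReal.ofReal (Real.exp (c * |b z - m|)) := by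
          rw [lintegral_add_left measurable_const, setLIntegral_const,
            lintegral_const_mul' _ _ ENNReal.ofReal_ne_top]
      _ ≤ ENNReal.ofReal (L / c) * volume (closedBall x₀ ρ) + ENNReal.ofReal (Real.exp (-L) / c) *
            (4 * volume (closedBall y (3 * r))) := by
          gcongr
          exact (lintegral_mono_set hsub).trans (hbc y _ (by positivity))
      _ = _ := by
          rw [show 3 * r = 3 * r / ρ * ρ by field_simp,
            volume_closedBall_mul y x₀ hρ.le (by positivity), ← mul_assoc, ← mul_assoc,
            ← add_mul, ← ENNReal.ofReal_ofNat, ← ENNReal.ofReal_mul (by positivity),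
            ← ENNReal.ofReal_mul (by positivity),
            ← ENNReal.ofReal_add (by positivity) (by positivity), mul_assoc, ← hexpL,
            Real.exp_neg]
          congr 2
          have := Real.exp_pos L
          field_simp
  have h3 := abs_sub_le (⨍ z in closedBall x₀ ρ, b z) m (⨍ z in closedBall y r, b z)
  rw [abs_sub_comm m] at h3
  have h4 : (L + 1) / c = (1 + Real.log 4 + n * Real.log (3 * r / ρ)) / c := by rw [hL]; ring
  linarith

/-! ### Morrey bounds on small and large balls -/

/-- `f` has Zygmund-Morrey norm at most `N`, in terms of the modular over balls. -/
def HasMorreyBound {n : ℕ} (lam N : ℝ) (f : (Fin n → ℝ) → ℝ) : Prop :=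
  ∀ x r, 0 < r → ∫⁻ z in closedBall x r,
    ENNReal.ofReal (zygmundFun (|f z| / (N * (2 * r) ^ (-lam)))) ≤ volume (closedBall x r)

theorem HasMorreyBound.modular_le {n : ℕ} {lam N : ℝ} {f : (Fin n → ℝ) → ℝ}
    (hf : HasMorreyBound lam N f) (hN : 0 < N) (x : Fin n → ℝ) {r α : ℝ} (hr : 0 < r)
    (hα : N * (2 * r) ^ (-lam) ≤ α) :
    ∫⁻ z in closedBall x r, ENNReal.ofReal (zygmundFun (|f z| / α)) ≤
      volume (closedBall x r) := by
  refine le_trans (lintegral_mono fun z => ENNReal.ofReal_le_ofReal ?_) (hf x r hr)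
  have h0 : 0 < N * (2 * r) ^ (-lam) := by positivity
  have h1 : 0 < α := h0.trans_le hα
  refine zygmundFun_mono (by positivity) ?_
  gcongr

theorem HasMorreyBound.lintegral_le {n : ℕ} {lam N : ℝ} {f : (Fin n → ℝ) → ℝ}
    (hf : HasMorreyBound lam N f) (hN : 0 < N) (x : Fin n → ℝ) {r α : ℝ} (hr : 0 < r)
    (hα : N * (2 * r) ^ (-lam) ≤ α) :
    ∫⁻ z in closedBall x r, ‖f z‖ₑ ≤ ENNReal.ofReal α * volume (closedBall x r) := by
  have h0 : 0 < N * (2 * r) ^ (-lam) := by positivity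
  have h1 : 0 < α := h0.trans_le hα
  refine le_trans ?_ (mul_le_mul_right (hf.modular_le hN x hr hα) _)
  rw [← lintegral_const_mul' _ _ ENNReal.ofReal_ne_top]
  refine lintegral_mono fun z => ?_
  rw [← ENNReal.ofReal_mul h1.le, Real.enorm_eq_ofReal_abs]
  refine ENNReal.ofReal_le_ofReal ?_
  rw [← div_le_iff₀' h1]
  exact le_zygmundFun (by positivity)

theorem morreyRadius_anti {lam N : ℝ} (hlam : 0 < lam) (hN : 0 < N) {ρ r : ℝ} (hρ : 0 < ρ)
    (hr : ρ ≤ r) : N * (2 * r) ^ (-lam) ≤ N * (2 * ρ) ^ (-lam) := by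
  gcongr ?_ * ?_
  exact Real.rpow_le_rpow_of_nonpos (by positivity) (by linarith) (by linarith)

theorem volume_triple {n : ℕ} (x : Fin n → ℝ) {ρ : ℝ} (hρ : 0 < ρ) :
    volume (closedBall x (3 * ρ)) = ENNReal.ofReal (3 ^ n) * volume (closedBall x ρ) :=
  volume_closedBall_mul x x hρ.le three_pos.le

theorem closedBall_subset_triple {n : ℕ} {x x₀ y : Fin n → ℝ} {r ρ : ℝ}
    (hx : x ∈ closedBall x₀ ρ) (hy : x ∈ closedBall y r) (hr : r ≤ ρ) :
    closedBall y r ⊆ closedBall x₀ (3 * ρ) := by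
  refine closedBall_subset_closedBall' ?_
  rw [mem_closedBall] at hx
  rw [mem_closedBall'] at hy
  have := dist_triangle y x x₀
  linarith

/-- The maximal function maps the Zygmund-Morrey space to a weak Morrey space. -/
theorem HasMorreyBound.volume_maximal_le {n : ℕ} {lam N : ℝ} {f : (Fin n → ℝ) → ℝ}
    (hlam : 0 < lam) (hf : HasMorreyBound lam N f) (hN : 0 < N) (x₀ : Fin n → ℝ) {ρ s : ℝ}
    (hρ : 0 < ρ) (hs : 0 < s) :
    volume {x ∈ closedBall x₀ ρ | ∃ y r, 0 < r ∧ x ∈ closedBall y r ∧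
      ENNReal.ofReal s * volume (closedBall y r) < ∫⁻ z in closedBall y r, ‖f z‖ₑ} ≤
    ENNReal.ofReal ((1 + 5 ^ n * 3 ^ n) * (N * (2 * ρ) ^ (-lam)) / s) *
      volume (closedBall x₀ ρ) := by
  set α := N * (2 * ρ) ^ (-lam) with hα
  have hα0 : 0 < α := by positivity
  -- Below the Morrey level `α` the claimed bound already exceeds the volume of the ball.
  rcases le_total s α with hsα | hsα
  · refine (measure_mono (sep_subset _ _)).trans (le_mul_of_one_le_left' ?_)
    rw [ENNReal.one_le_ofReal, one_le_div hs]
    nlinarith [show (0 : ℝ) ≤ 5 ^ n * 3 ^ n * α by positivity]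
  refine (volume_le_of_forall_exists_ball (fun y r => closedBall y r ⊆ closedBall x₀ (3 * ρ) ∧
    ENNReal.ofReal s * volume (closedBall y r) < ∫⁻ z in closedBall y r, ‖f z‖ₑ) ρ
    (closedBall x₀ (3 * ρ)) _ (fun z => ENNReal.ofReal s⁻¹ * ‖f z‖ₑ) ?_ ?_).trans ?_
  · rintro y r hr - ⟨hsub, hlt⟩
    refine ⟨hsub, ?_⟩
    rw [lintegral_const_mul' _ _ ENNReal.ofReal_ne_top]
    calc volume (closedBall y r)
        = ENNReal.ofReal s⁻¹ * (ENNReal.ofReal s * volume (closedBall y r)) := by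
          rw [← mul_assoc, ← ENNReal.ofReal_mul (by positivity), inv_mul_cancel₀ hs.ne',
            ENNReal.ofReal_one, one_mul]
      _ ≤ _ := by gcongr
  · rintro x ⟨hx, y, r, hr, hy, hlt⟩
    have hrρ : r ≤ ρ := by
      -- A ball of radius above `ρ` has mean of |f| at most α ≤ s, so only small balls can be
      -- responsible.
      by_contra! hcon
      refine hlt.not_ge ((hf.lintegral_le hN y hr
        (morreyRadius_anti hlam hN hρ hcon.le)).trans ?_)
      gcongr
    exact ⟨y, r, hr, hrρ, ⟨closedBall_subset_triple hx hy hrρ, hlt⟩, hy⟩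
  · rw [lintegral_const_mul' _ _ ENNReal.ofReal_ne_top]
    have h3 := hf.lintegral_le hN x₀ (r := 3 * ρ) (α := α) (by positivity)
      (morreyRadius_anti hlam hN hρ (by linarith))
    rw [volume_triple x₀ hρ] at h3
    refine (mul_le_mul_right (mul_le_mul_right h3 _) _).trans ?_
    rw [show (5 : ℝ≥0∞) ^ n = ENNReal.ofReal (5 ^ n) by
      rw [ENNReal.ofReal_pow (by norm_num), ENNReal.ofReal_ofNat], ← mul_assoc, ← mul_assoc,
      ← mul_assoc, ← ENNReal.ofReal_mul (by positivity), ← ENNReal.ofReal_mul (by positivity),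
      ← ENNReal.ofReal_mul (by positivity)]
    gcongr
    rw [le_div_iff₀ hs]
    field_simp
    nlinarith

/-- The bound for the difference of means, weighted by the Morrey decay. -/
theorem rpow_mul_log_le {n : ℕ} {lam c : ℝ} (hlam : 0 < lam) (hc : 0 < c) {ρ r : ℝ}
    (hρ : 0 < ρ) (hr : ρ ≤ r) :
    (2 * r) ^ (-lam) * (3 ^ n + (1 + Real.log 4 + n * Real.log (3 * r / ρ)) / c) ≤
      (2 * ρ) ^ (-lam) * (3 ^ n + (1 + Real.log 4 + n * Real.log 3 + n / lam) / c) := by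
  have hr0 : 0 < r := hρ.trans_le hr
  set q := r / ρ with hq
  have hq1 : 1 ≤ q := (one_le_div hρ).2 hr
  have hq0 : 0 < q := by linarith
  have h1 : (2 * r) ^ (-lam) = (2 * ρ) ^ (-lam) * (q ^ lam)⁻¹ := by
    rw [← Real.rpow_neg hq0.le, ← Real.mul_rpow (by positivity) hq0.le, hq]
    congr 1
    field_simp
  have h2 : Real.log (3 * r / ρ) = Real.log 3 + Real.log q := by
    rw [mul_div_assoc, Real.log_mul (by norm_num) hq0.ne']
  -- The logarithmic growth of the means is beaten by the power decay; this uses `0 < lam`.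
  have h3 : Real.log q ≤ q ^ lam / lam := Real.log_le_rpow_div hq0.le hlam
  have h4 : 1 ≤ q ^ lam := Real.one_le_rpow hq1 hlam.le
  have hl4 : 0 ≤ Real.log 4 := Real.log_nonneg (by norm_num)
  have hl3 : 0 ≤ Real.log 3 := Real.log_nonneg (by norm_num)
  rw [h1, mul_assoc, h2]
  gcongr
  rw [inv_mul_le_iff₀ (by positivity)]
  have h5 : 3 ^ n + (1 + Real.log 4 + n * (Real.log 3 + Real.log q)) / c ≤
      3 ^ n + (1 + Real.log 4 + n * (Real.log 3 + q ^ lam / lam)) / c := by gcongr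
  refine h5.trans ?_
  have h6 : q ^ lam * (3 ^ n + (1 + Real.log 4 + n * Real.log 3 + n / lam) / c) -
      (3 ^ n + (1 + Real.log 4 + n * (Real.log 3 + q ^ lam / lam)) / c) =
      (q ^ lam - 1) * (3 ^ n + (1 + Real.log 4 + n * Real.log 3) / c) := by
    field_simp; ring
  have h7 : 0 ≤ (q ^ lam - 1) * (3 ^ n + (1 + Real.log 4 + n * Real.log 3) / c) :=
    mul_nonneg (by linarith) (by positivity)
  linarith

theorem lintegral_sub_mul_le {n : ℕ} {b f : (Fin n → ℝ) → ℝ} (hf : AEMeasurable f)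
    (S : Set (Fin n → ℝ)) (t m : ℝ) :
    ∫⁻ z in S, ‖t - b z‖ₑ * ‖f z‖ₑ ≤
      ‖t - m‖ₑ * (∫⁻ z in S, ‖f z‖ₑ) + ∫⁻ z in S, ‖b z - m‖ₑ * ‖f z‖ₑ := by
  rw [← lintegral_const_mul' _ _ enorm_ne_top,
    ← lintegral_add_left' (hf.restrict.enorm.const_mul _)]
  refine lintegral_mono fun z => ?_
  rw [← add_mul, show t - b z = (t - m) - (b z - m) by ring]
  gcongr
  exact enorm_sub_le

/-- Weak type estimate over small balls for the mean of `|b - b_B| |f|`. -/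
theorem HasMorreyBound.volume_oscillation_le {n : ℕ} {lam N c : ℝ} {b f : (Fin n → ℝ) → ℝ}
    (hb : HasUnitOscillation b) (hc : 0 < c) (hbc : HasExpOscillation c b)
    (hlam : 0 < lam) (hf : HasMorreyBound lam N f) (hN : 0 < N) (x₀ : Fin n → ℝ) {ρ s : ℝ}
    (hρ : 0 < ρ) (hs : 5 / c * (N * (2 * ρ) ^ (-lam)) ≤ s) :
    volume {x | ∃ y r, 0 < r ∧ r ≤ ρ ∧ (closedBall y r ⊆ closedBall x₀ (3 * ρ) ∧
      ENNReal.ofReal s * volume (closedBall y r) <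
        ∫⁻ z in closedBall y r, ‖b z - ⨍ w in closedBall y r, b w‖ₑ * ‖f z‖ₑ) ∧
        x ∈ closedBall y r} ≤
    ENNReal.ofReal (5 ^ n * (5 / c) * 3 ^ n * (N * (2 * ρ) ^ (-lam)) / s) *
      volume (closedBall x₀ ρ) := by
  set α := N * (2 * ρ) ^ (-lam) with hα
  have hα0 : 0 < α := by positivity
  have hs0 : 0 < s := lt_of_lt_of_le (by positivity) hs
  -- If the modular of |f|/σ over a ball were at most its volume, Young's inequality would bound the
  -- mean by 5σ/c = s. Hence the modular density is a valid mass for Vitali.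
  set σ := s / (5 / c) with hσ
  have hσ0 : 0 < σ := by positivity
  have hασ : α ≤ σ := by rw [hσ, le_div_iff₀ (by positivity)]; linarith
  have hsσ : s = 5 / c * σ := by rw [hσ]; field_simp
  refine (volume_le_of_forall_exists_ball _ ρ (closedBall x₀ (3 * ρ)) _
    (fun z => ENNReal.ofReal (zygmundFun (|f z| / σ))) ?_ (fun x hx => hx)).trans ?_
  · rintro y r hr - ⟨hsub, hlt⟩
    refine ⟨hsub, ?_⟩
    by_contra! hcon
    refine hlt.not_ge ?_
    have h1 := hbc.lintegral_mul_le hb hc (fun z => by positivity) hr hcon.le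
    have h2 : ∀ z, ‖f z‖ₑ = ENNReal.ofReal σ * ENNReal.ofReal (|f z| / σ) := by
      intro z
      rw [← ENNReal.ofReal_mul hσ0.le, mul_div_cancel₀ _ hσ0.ne', Real.enorm_eq_ofReal_abs]
    simp_rw [h2, mul_left_comm]
    rw [lintegral_const_mul' _ _ ENNReal.ofReal_ne_top, hsσ, mul_comm (5 / c),
      ENNReal.ofReal_mul hσ0.le, mul_assoc]
    gcongr
  · have h1 : ∫⁻ z in closedBall x₀ (3 * ρ), ENNReal.ofReal (zygmundFun (|f z| / σ)) ≤
        ENNReal.ofReal (α / σ) * volume (closedBall x₀ (3 * ρ)) := by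
      refine le_trans ?_ (mul_le_mul_right (hf.modular_le hN x₀ (r := 3 * ρ) (α := α)
        (by positivity) (morreyRadius_anti hlam hN hρ (by linarith))) _)
      rw [← lintegral_const_mul' _ _ ENNReal.ofReal_ne_top]
      refine lintegral_mono fun z => ?_
      rw [← ENNReal.ofReal_mul (by positivity)]
      refine ENNReal.ofReal_le_ofReal ?_
      rw [show |f z| / σ = α / σ * (|f z| / α) by field_simp]
      exact zygmundFun_mul_le (by positivity) ((div_le_one hσ0).2 hασ) (by positivity)
    rw [volume_triple x₀ hρ] at h1
    refine (mul_le_mul_right h1 _).trans ?_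
    rw [show (5 : ℝ≥0∞) ^ n = ENNReal.ofReal (5 ^ n) by
      rw [ENNReal.ofReal_pow (by norm_num), ENNReal.ofReal_ofNat], ← mul_assoc, ← mul_assoc,
      ← ENNReal.ofReal_mul (by positivity), ← ENNReal.ofReal_mul (by positivity)]
    refine le_of_eq ?_
    congr 2
    rw [hσ]
    field_simp

/-- On large balls the maximal commutator is controlled by the oscillation of `b` alone. -/
theorem HasMorreyBound.lintegral_large_le {n : ℕ} {lam N c : ℝ} {b f : (Fin n → ℝ) → ℝ}
    (hb : HasUnitOscillation b) (hc : 0 < c) (hbc : HasExpOscillation c b)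
    (hlam : 0 < lam) (hf : HasMorreyBound lam N f) (hfm : AEMeasurable f) (hN : 0 < N)
    {x x₀ y : Fin n → ℝ} {ρ r : ℝ} (hρ : 0 < ρ) (hr : ρ ≤ r)
    (hx : x ∈ closedBall x₀ ρ) (hy : x ∈ closedBall y r) :
    ∫⁻ z in closedBall y r, ‖b x - b z‖ₑ * ‖f z‖ₑ ≤
      ENNReal.ofReal (N * (2 * ρ) ^ (-lam) * (|b x - ⨍ z in closedBall x₀ ρ, b z| +
        (3 ^ n + (1 + Real.log 4 + n * Real.log 3 + n / lam) / c + 5 / c))) *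
      volume (closedBall y r) := by
  have hr0 : 0 < r := hρ.trans_le hr
  set β := N * (2 * r) ^ (-lam) with hβ
  have hβ0 : 0 < β := by positivity
  have hβα : β ≤ N * (2 * ρ) ^ (-lam) := morreyRadius_anti hlam hN hρ hr
  set D := 3 ^ n + (1 + Real.log 4 + n * Real.log 3 + n / lam) / c with hD
  have hmeans := hbc.abs_average_sub_average_le hb hc hρ hr ⟨x, hx, hy⟩
  set m := ⨍ z in closedBall y r, b z
  set m₀ := ⨍ z in closedBall x₀ ρ, b z
  -- The decay of `β` in `r` must be spent before `β` is replaced by its value at `ρ`, since |m₀ -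
  -- m| is not bounded uniformly in `r`.
  have hdiff : β * |m₀ - m| ≤ N * (2 * ρ) ^ (-lam) * D := by
    calc β * |m₀ - m| ≤ N * ((2 * r) ^ (-lam) *
          (3 ^ n + (1 + Real.log 4 + n * Real.log (3 * r / ρ)) / c)) := by
          rw [hβ, mul_assoc]; gcongr
      _ ≤ N * ((2 * ρ) ^ (-lam) * D) := by
          exact mul_le_mul_of_nonneg_left (rpow_mul_log_le hlam hc hρ hr) hN.le
      _ = _ := by ring
  have h1 : ∫⁻ z in closedBall y r, ‖b z - m‖ₑ * ‖f z‖ₑ ≤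
      ENNReal.ofReal (β * (5 / c)) * volume (closedBall y r) := by
    have h2 : ∀ z, ‖f z‖ₑ = ENNReal.ofReal β * ENNReal.ofReal (|f z| / β) := by
      intro z
      rw [← ENNReal.ofReal_mul hβ0.le, mul_div_cancel₀ _ hβ0.ne', Real.enorm_eq_ofReal_abs]
    simp_rw [h2, mul_left_comm]
    rw [lintegral_const_mul' _ _ ENNReal.ofReal_ne_top, ENNReal.ofReal_mul hβ0.le, mul_assoc]
    gcongr
    exact hbc.lintegral_mul_le hb hc (fun z => by positivity) hr0 (hf y r hr0)
  refine (lintegral_sub_mul_le hfm _ _ m).trans ?_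
  refine (add_le_add (mul_le_mul_right (hf.lintegral_le hN y hr0 le_rfl) _) h1).trans ?_
  rw [← mul_assoc, ← add_mul, Real.enorm_eq_ofReal_abs, ← ENNReal.ofReal_mul (abs_nonneg _),
    ← ENNReal.ofReal_add (by positivity) (by positivity)]
  gcongr
  have h3 := abs_sub_le (b x) m₀ m
  have h4 : |b x - m| * β ≤ N * (2 * ρ) ^ (-lam) * |b x - m₀| + N * (2 * ρ) ^ (-lam) * D := by
    calc |b x - m| * β ≤ (|b x - m₀| + |m₀ - m|) * β := by gcongr
      _ = β * |b x - m₀| + β * |m₀ - m| := by ring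
      _ ≤ _ := by gcongr
  have h5 : β * (5 / c) ≤ N * (2 * ρ) ^ (-lam) * (5 / c) := by gcongr
  linarith

/-! ### The maximal commutator with normalised symbol -/

/-- The maximal commutator maps the Zygmund-Morrey space to a weak Morrey space. -/
theorem exists_volume_maximalCommutator_le (n : ℕ) {lam : ℝ} (hlam : 0 < lam) :
    ∃ C : ℝ, 0 < C ∧ ∀ b f : (Fin n → ℝ) → ℝ, ∀ N : ℝ, HasUnitOscillation b → AEMeasurable f →
      0 < N → HasMorreyBound lam N f → ∀ (x₀ : Fin n → ℝ) (ρ s : ℝ), 0 < ρ → 0 < s →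
      volume {x ∈ closedBall x₀ ρ | ∃ y r, 0 < r ∧ x ∈ closedBall y r ∧
        ENNReal.ofReal s * volume (closedBall y r) <
          ∫⁻ z in closedBall y r, ‖b x - b z‖ₑ * ‖f z‖ₑ} ≤
      ENNReal.ofReal (C * (N * (2 * ρ) ^ (-lam)) / s) * volume (closedBall x₀ ρ) := by
  obtain ⟨c, hc, hJN⟩ := exists_john_nirenberg n
  set D := 3 ^ n + (1 + Real.log 4 + n * Real.log 3 + n / lam) / c + 5 / c with hD
  set C₁ : ℝ := 5 ^ n * (1 + 4 * ((1 + 5 ^ n) * (32 / c ^ 2))) with hC₁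
  set C₂ : ℝ := 5 ^ n * (5 / c) * 3 ^ n with hC₂
  have hl4 : 0 ≤ Real.log 4 := Real.log_nonneg (by norm_num)
  have hl3 : 0 ≤ Real.log 3 := Real.log_nonneg (by norm_num)
  have hD0 : 0 < D := by rw [hD]; positivity
  have hC₁0 : 0 < C₁ := by rw [hC₁]; positivity
  have hC₂0 : 0 < C₂ := by rw [hC₂]; positivity
  have h5c : 0 < 10 / c := by positivity
  refine ⟨10 / c + 2 * D + C₁ * 2 * 3 ^ n + C₂ * 2 + 2, by positivity, ?_⟩
  intro b f N hb hfm hN hf x₀ ρ s hρ hs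
  have hbc : HasExpOscillation c b := hJN b hb
  set α := N * (2 * ρ) ^ (-lam) with hα
  have hα0 : 0 < α := by positivity
  -- For small `s` the bound is trivial. Otherwise s/2 ≥ (5/c)α, as required by the mean oscillation
  -- estimate, and s/2 ≥ Dα, so that the constant term on large balls uses up at most half of `s`.
  rcases le_total s ((10 / c + 2 * D) * α) with hsα | hsα
  · refine (measure_mono (sep_subset _ _)).trans (le_mul_of_one_le_left' ?_)
    rw [ENNReal.one_le_ofReal, one_le_div hs]
    refine hsα.trans (mul_le_mul_of_nonneg_right ?_ hα0.le)
    have : 0 < C₁ * 2 * 3 ^ n := by positivity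
    linarith
  have hs10 : 10 / c * α ≤ s := le_trans (by gcongr; linarith) hsα
  have hsD : 2 * D * α ≤ s := le_trans (by gcongr; linarith) hsα
  have hmul := hb.volume_oscillation_mul_le hc hbc (closedBall x₀ (3 * ρ)) ρ
    (fun z => ENNReal.ofReal (s / 2)⁻¹ * ‖f z‖ₑ)
  rw [lintegral_const_mul' _ _ ENNReal.ofReal_ne_top] at hmul
  have hmul' := hmul.trans (mul_le_mul_right (mul_le_mul_right (hf.lintegral_le hN x₀
    (r := 3 * ρ) (α := α) (by positivity) (morreyRadius_anti hlam hN hρ (by linarith))) _) _)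
  rw [volume_triple x₀ hρ, ← mul_assoc, ← mul_assoc, ← mul_assoc,
    ← ENNReal.ofReal_mul (by positivity), ← ENNReal.ofReal_mul (by positivity),
    ← ENNReal.ofReal_mul (by positivity)] at hmul'
  have hosc := hf.volume_oscillation_le hb hc hbc hlam hN x₀ hρ (s := s / 2) (by
    rw [← hα]; linarith [show 10 / c * α = 2 * (5 / c * α) by ring])
  set m₀ := ⨍ z in closedBall x₀ ρ, b z with hm₀
  -- Chebyshev for |b - m₀|: on large balls the excess over `s` leaves α|b x - m₀| ≥ s/2.
  have hlarge : volume {x ∈ closedBall x₀ ρ |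
      1 ≤ ENNReal.ofReal (2 * α / s) * ‖b x - m₀‖ₑ} ≤
      ENNReal.ofReal (2 * α / s) * volume (closedBall x₀ ρ) := by
    refine (volume_ge_le_lintegral measurableSet_closedBall
      ((hb.aemeasurable.sub_const m₀).enorm.const_mul _)).trans ?_
    rw [lintegral_const_mul' _ _ ENNReal.ofReal_ne_top]
    gcongr
    exact hb.2 x₀ ρ hρ
  refine (measure_mono ?_).trans ((measure_union_le _ _).trans ((add_le_add
    ((measure_union_le _ _).trans (add_le_add hmul' hosc)) hlarge).trans ?_))
  · rintro x ⟨hx, y, r, hr, hy, hlt⟩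
    rcases le_total r ρ with hrρ | hrρ
    · left
      have hsub := closedBall_subset_triple hx hy hrρ
      by_cases hcase : ENNReal.ofReal (s / 2) * volume (closedBall y r) <
          ∫⁻ z in closedBall y r, ‖b z - ⨍ w in closedBall y r, b w‖ₑ * ‖f z‖ₑ
      · exact Or.inr ⟨y, r, hr, hrρ, ⟨hsub, hcase⟩, hy⟩
      · refine Or.inl ⟨y, r, hr, hrρ, hy, hsub, ?_⟩
        have h1 := hlt.trans_le (lintegral_sub_mul_le hfm _ _ (⨍ w in closedBall y r, b w))
        have h2 : ENNReal.ofReal (s / 2) * volume (closedBall y r) <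
            ‖b x - ⨍ w in closedBall y r, b w‖ₑ * ∫⁻ z in closedBall y r, ‖f z‖ₑ := by
          by_contra! hcon
          refine h1.not_ge ((add_le_add hcon (not_lt.1 hcase)).trans (le_of_eq ?_))
          rw [← add_mul, ← ENNReal.ofReal_add (by positivity) (by positivity), add_halves]
        rw [lintegral_const_mul' _ _ ENNReal.ofReal_ne_top, mul_left_comm]
        calc volume (closedBall y r) = ENNReal.ofReal (s / 2)⁻¹ *
              (ENNReal.ofReal (s / 2) * volume (closedBall y r)) := by
              rw [← mul_assoc, ← ENNReal.ofReal_mul (by positivity),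
                inv_mul_cancel₀ (by positivity), ENNReal.ofReal_one, one_mul]
          _ < _ := ENNReal.mul_lt_mul_right (by simpa using hs) ENNReal.ofReal_ne_top h2
    · refine Or.inr ⟨hx, ?_⟩
      have h1 := hlt.trans_le (hf.lintegral_large_le hb hc hbc hlam hfm hN hρ hrρ hx hy)
      have h2 := lt_of_mul_lt_mul_right' h1
      rw [ENNReal.ofReal_lt_ofReal_iff_of_nonneg hs.le, ← hα, ← hD, ← hm₀] at h2
      rw [Real.enorm_eq_ofReal_abs, ← ENNReal.ofReal_mul (by positivity), ENNReal.one_le_ofReal,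
        div_mul_eq_mul_div, one_le_div hs]
      linarith
  · rw [← add_mul, ← add_mul, ← ENNReal.ofReal_add (by positivity) (by positivity),
      ← ENNReal.ofReal_add (by positivity) (by positivity)]
    gcongr
    rw [le_div_iff₀ hs]
    have h1 : (C₁ * (s / 2)⁻¹ * α * 3 ^ n + C₂ * α / (s / 2) + 2 * α / s) * s =
        (C₁ * 2 * 3 ^ n + C₂ * 2 + 2) * α := by field_simp
    rw [h1]
    gcongr
    linarith

/-! ### From cubes to balls, and measurability of maximal functions -/

theorem closedBall_eq_cube {n : ℕ} (x : Fin n → ℝ) {r : ℝ} (hr : 0 ≤ r) :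
    closedBall x r = cube (fun i => x i - r) (2 * r) := by
  ext y
  rw [mem_closedBall, dist_pi_le_iff hr, cube, mem_Icc, Pi.le_def, Pi.le_def, ← forall_and]
  refine forall_congr' fun i => ?_
  rw [Real.dist_eq, abs_le]
  constructor <;> rintro ⟨h1, h2⟩ <;> constructor <;> linarith

theorem cube_eq_closedBall {n : ℕ} (a : Fin n → ℝ) {l : ℝ} (hl : 0 ≤ l) :
    cube a l = closedBall (fun i => a i + l / 2) (l / 2) := by
  rw [closedBall_eq_cube _ (by positivity)]
  congr 1
  · simp
  · ring

/-- The supremum of the means of `h` over all balls containing `x`. -/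
noncomputable def supMean {n : ℕ} (h : (Fin n → ℝ) → ℝ≥0∞) (x : Fin n → ℝ) : ℝ≥0∞ :=
  ⨆ (y : Fin n → ℝ) (r : ℝ) (_ : 0 < r) (_ : x ∈ closedBall y r),
    (volume (closedBall y r))⁻¹ * ∫⁻ z in closedBall y r, h z

theorem iSup_cube_eq_iSup_closedBall {n : ℕ} (F : Set (Fin n → ℝ) → ℝ≥0∞) :
    ⨆ (a : Fin n → ℝ) (l : ℝ) (_ : 0 < l), F (cube a l) =
      ⨆ (y : Fin n → ℝ) (r : ℝ) (_ : 0 < r), F (closedBall y r) := by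
  refine le_antisymm (iSup_le fun a => iSup_le fun l => iSup_le fun hl => ?_)
    (iSup_le fun y => iSup_le fun r => iSup_le fun hr => ?_)
  · rw [cube_eq_closedBall a hl.le]
    exact le_iSup_of_le _ (le_iSup_of_le _ (le_iSup_of_le (half_pos hl) le_rfl))
  · rw [closedBall_eq_cube y hr.le]
    exact le_iSup_of_le _ (le_iSup_of_le _ (le_iSup_of_le (mul_pos two_pos hr) le_rfl))

theorem maximal_eq_supMean {n : ℕ} (f : (Fin n → ℝ) → ℝ) (x : Fin n → ℝ) :
    maximal f x = supMean (fun z => ‖f z‖ₑ) x :=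
  iSup_cube_eq_iSup_closedBall fun Q => ⨆ (_ : x ∈ Q), (volume Q)⁻¹ * ∫⁻ z in Q, ‖f z‖ₑ

theorem lt_supMean_iff {n : ℕ} {h : (Fin n → ℝ) → ℝ≥0∞} {x : Fin n → ℝ} {t : ℝ≥0∞} :
    t < supMean h x ↔ ∃ y r, 0 < r ∧ x ∈ closedBall y r ∧
      t * volume (closedBall y r) < ∫⁻ z in closedBall y r, h z := by
  simp only [supMean, lt_iSup_iff, exists_prop]
  refine exists_congr fun y => exists_congr fun r => and_congr_right fun hr =>
    and_congr_right fun _ => ?_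
  rw [mul_comm, ← div_eq_mul_inv, ENNReal.lt_div_iff_mul_lt
    (Or.inl (volume_closedBall_pos y hr).ne') (Or.inl (volume_closedBall_ne_top y r))]

theorem supMean_mono_ae {n : ℕ} {g h : (Fin n → ℝ) → ℝ≥0∞} (hgh : ∀ᵐ z, g z ≤ h z)
    (x : Fin n → ℝ) : supMean g x ≤ supMean h x := by
  refine iSup₂_mono fun y r => iSup₂_mono fun hr hx => mul_le_mul_right ?_ _
  exact lintegral_mono_ae (ae_restrict_of_ae hgh)

theorem supMean_add_le {n : ℕ} {g h : (Fin n → ℝ) → ℝ≥0∞} (hg : AEMeasurable g)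
    (x : Fin n → ℝ) : supMean (fun z => g z + h z) x ≤ supMean g x + supMean h x := by
  refine iSup_le fun y => iSup_le fun r => iSup_le fun hr => iSup_le fun hx => ?_
  rw [lintegral_add_left' hg.restrict, mul_add]
  exact add_le_add
    (le_iSup_of_le y (le_iSup_of_le r (le_iSup_of_le hr (le_iSup_of_le hx le_rfl))))
    (le_iSup_of_le y (le_iSup_of_le r (le_iSup_of_le hr (le_iSup_of_le hx le_rfl))))

theorem supMean_const_mul {n : ℕ} (k : ℝ≥0∞) (hk : k ≠ ∞) (h : (Fin n → ℝ) → ℝ≥0∞)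
    (x : Fin n → ℝ) : supMean (fun z => k * h z) x = k * supMean h x := by
  simp only [supMean, ENNReal.mul_iSup, lintegral_const_mul' _ _ hk, mul_left_comm]

/-- A strict inequality for the mean survives a slight enlargement of the closed ball, whose
interior then contains a neighbourhood of `x` even when `x` was on the boundary. This gives Borel
measurability with no assumption on `h`. -/
theorem lowerSemicontinuous_supMean {n : ℕ} (h : (Fin n → ℝ) → ℝ≥0∞) :
    LowerSemicontinuous (supMean h) := by
  refine lowerSemicontinuous_iff_isOpen_preimage.2 fun t => isOpen_iff_mem_nhds.2 fun x hx => ?_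
  obtain ⟨y, r, hr, hxy, hlt⟩ := lt_supMean_iff.1 hx
  have hcont : Tendsto (fun k : ℝ => t * volume (closedBall y k)) (𝓝[>] r)
      (𝓝 (t * volume (closedBall y r))) := by
    have ht : t ≠ ∞ := ne_top_of_lt hx
    refine ENNReal.Tendsto.const_mul ?_ (Or.inr ht)
    have h1 : Tendsto (fun k : ℝ => ENNReal.ofReal ((2 * k) ^ n)) (𝓝[>] r)
        (𝓝 (ENNReal.ofReal ((2 * r) ^ n))) :=
      ((ENNReal.continuous_ofReal.comp (by fun_prop : Continuous fun k : ℝ => (2 * k) ^ n)).tendsto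
        r).mono_left nhdsWithin_le_nhds
    rw [Real.volume_pi_closedBall y hr.le, Fintype.card_fin]
    refine h1.congr' ?_
    filter_upwards [self_mem_nhdsWithin] with k hk
    rw [Real.volume_pi_closedBall y (hr.trans hk).le, Fintype.card_fin]
  obtain ⟨k, hk, hrk⟩ := ((hcont.eventually (gt_mem_nhds hlt)).and self_mem_nhdsWithin).exists
  refine mem_of_superset (isOpen_ball.mem_nhds
    (show x ∈ ball y k from lt_of_le_of_lt hxy hrk)) fun w hw => ?_
  exact lt_supMean_iff.2 ⟨y, k, hr.trans hrk, ball_subset_closedBall hw,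
    hk.trans_le (lintegral_mono_set (closedBall_subset_closedBall (le_of_lt hrk)))⟩

theorem aemeasurable_maximalCommutator {n : ℕ} {b : (Fin n → ℝ) → ℝ} (hb : AEMeasurable b)
    (f : (Fin n → ℝ) → ℝ) : AEMeasurable (maximalCommutator b f) := by
  have h : ∀ g : (Fin n → ℝ) → ℝ, Measurable (maximal g) := fun g => by
    rw [funext (maximal_eq_supMean g)]
    exact (lowerSemicontinuous_supMean _).measurable
  exact ((h _).ennreal_toReal.aemeasurable).sub (hb.mul (h f).ennreal_toReal.aemeasurable)

/-! ### Normalising the BMO and Morrey norms -/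

theorem bmoNorm_eq {n : ℕ} (f : (Fin n → ℝ) → ℝ) :
    bmoNorm f = ⨆ (x : Fin n → ℝ) (r : ℝ) (_ : 0 < r), (volume (closedBall x r))⁻¹ *
      ∫⁻ y in closedBall x r, ‖f y - ⨍ z in closedBall x r, f z‖ₑ :=
  iSup_cube_eq_iSup_closedBall fun Q => (volume Q)⁻¹ * ∫⁻ y in Q, ‖f y - ⨍ z in Q, f z‖ₑ

theorem lintegral_oscillation_le {n : ℕ} (f : (Fin n → ℝ) → ℝ) (x : Fin n → ℝ) {r : ℝ}
    (hr : 0 < r) : ∫⁻ y in closedBall x r, ‖f y - ⨍ z in closedBall x r, f z‖ₑ ≤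
      bmoNorm f * volume (closedBall x r) := by
  rw [← ENNReal.div_le_iff (volume_closedBall_pos x hr).ne' (volume_closedBall_ne_top x r),
    div_eq_mul_inv, mul_comm, bmoNorm_eq]
  exact le_iSup_of_le x (le_iSup_of_le r (le_iSup_of_le hr le_rfl))

/-- The positive part is a 1-Lipschitz function of `b`, so it oscillates no more than `b` about the
positive part of the mean; recentring at its own mean doubles the bound. Only the finiteness is used
later. -/
theorem bmoNorm_max_zero_lt_top {n : ℕ} {b : (Fin n → ℝ) → ℝ} (hb : MemBMO b) :
    bmoNorm (fun x => max (b x) 0) < ∞ ∧ LocallyIntegrable (fun x => max (b x) 0) := by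
  have hloc : LocallyIntegrable (fun x => max (b x) 0) := by
    refine hb.1.mono (hb.1.aestronglyMeasurable.aemeasurable.max
      aemeasurable_const).aestronglyMeasurable (Eventually.of_forall fun x => ?_)
    rw [Real.norm_eq_abs, Real.norm_eq_abs]
    rcases le_total (b x) 0 with h | h
    · rw [max_eq_right h, abs_zero]; positivity
    · rw [max_eq_left h]
  refine ⟨?_, hloc⟩
  set κ := (bmoNorm b).toReal with hκ
  have hκ' : bmoNorm b = ENNReal.ofReal κ := (ENNReal.ofReal_toReal hb.2.ne).symm
  have hκ0 : 0 ≤ κ := ENNReal.toReal_nonneg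
  refine lt_of_le_of_lt ?_ (ENNReal.ofReal_lt_top (r := 2 * κ))
  rw [bmoNorm_eq]
  refine iSup_le fun x => iSup_le fun r => iSup_le fun hr => ?_
  set a := max (⨍ z in closedBall x r, b z) 0 with ha
  have h1 : ∫⁻ y in closedBall x r, ‖max (b y) 0 - a‖ₑ ≤
      ENNReal.ofReal κ * volume (closedBall x r) := by
    rw [← hκ']
    refine le_trans (lintegral_mono fun y => ?_) (lintegral_oscillation_le b x hr)
    rw [Real.enorm_eq_ofReal_abs, Real.enorm_eq_ofReal_abs]
    exact ENNReal.ofReal_le_ofReal (abs_max_sub_max_le_abs _ _ _)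
  have h2 := abs_average_sub_le (hloc.integrableOn_isCompact (isCompact_closedBall x r)) hr hκ0 h1
  rw [mul_comm, ← div_eq_mul_inv, ENNReal.div_le_iff (volume_closedBall_pos x hr).ne'
    (volume_closedBall_ne_top x r)]
  set m := ⨍ z in closedBall x r, max (b z) 0
  calc ∫⁻ y in closedBall x r, ‖max (b y) 0 - m‖ₑ
      ≤ ∫⁻ y in closedBall x r, (‖max (b y) 0 - a‖ₑ + ENNReal.ofReal κ) := by
        refine lintegral_mono fun y => ?_
        rw [show max (b y) 0 - m = (max (b y) 0 - a) - (m - a) by ring]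
        refine enorm_sub_le.trans ?_
        gcongr
        rw [Real.enorm_eq_ofReal_abs]
        exact ENNReal.ofReal_le_ofReal h2
    _ ≤ ENNReal.ofReal κ * volume (closedBall x r) +
          ENNReal.ofReal κ * volume (closedBall x r) := by
        rw [lintegral_add_right _ measurable_const, setLIntegral_const]
        gcongr
    _ = _ := by
        rw [← add_mul, ← ENNReal.ofReal_add hκ0 hκ0, two_mul]

theorem hasUnitOscillation_inv_mul {n : ℕ} {p : (Fin n → ℝ) → ℝ} (hp : LocallyIntegrable p)
    {B : ℝ} (hB : 0 < B) (h : bmoNorm p ≤ ENNReal.ofReal B) :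
    HasUnitOscillation fun x => B⁻¹ * p x := by
  refine ⟨hp.smul B⁻¹, fun x r hr => ?_⟩
  have h1 : ∀ y, ‖B⁻¹ * p y - ⨍ z in closedBall x r, B⁻¹ * p z‖ₑ =
      ENNReal.ofReal B⁻¹ * ‖p y - ⨍ z in closedBall x r, p z‖ₑ := by
    intro y
    rw [setAverage_eq, setAverage_eq, integral_const_mul, smul_eq_mul, smul_eq_mul,
      mul_left_comm, ← mul_sub, enorm_mul, Real.enorm_eq_ofReal (inv_pos.2 hB).le]
  simp_rw [h1]
  rw [lintegral_const_mul' _ _ ENNReal.ofReal_ne_top]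
  calc _ ≤ ENNReal.ofReal B⁻¹ * (ENNReal.ofReal B * volume (closedBall x r)) := by
        gcongr
        exact (lintegral_oscillation_le p x hr).trans (by gcongr)
    _ = _ := by
        rw [← mul_assoc, ← ENNReal.ofReal_mul (by positivity), inv_mul_cancel₀ hB.ne',
          ENNReal.ofReal_one, one_mul]

theorem volume_closedBall_rpow {n : ℕ} (hn : n ≠ 0) (lam : ℝ) (x : Fin n → ℝ) {r : ℝ}
    (hr : 0 < r) : volume (closedBall x r) ^ (lam / (n : ℝ)) = ENNReal.ofReal ((2 * r) ^ lam) := by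
  have hn' : (n : ℝ) ≠ 0 := Nat.cast_ne_zero.2 hn
  rw [Real.volume_pi_closedBall x hr.le, Fintype.card_fin,
    ENNReal.ofReal_rpow_of_pos (by positivity), ← Real.rpow_natCast,
    ← Real.rpow_mul (by positivity), mul_div_cancel₀ _ hn']

/-- The strict inequality provides an admissible `α` below the Morrey level, which avoids asking
whether the Luxemburg infimum is attained. -/
theorem hasMorreyBound_of_zygmundMorreyNorm_lt {n : ℕ} (hn : n ≠ 0) {lam N : ℝ}
    {f : (Fin n → ℝ) → ℝ} (h : zygmundMorreyNorm lam f < ENNReal.ofReal N) :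
    HasMorreyBound lam N f := by
  intro x r hr
  have hN : 0 < N := ENNReal.ofReal_pos.1 (bot_le.trans_lt h)
  have h2r : 0 < (2 * r) ^ lam := by positivity
  have h1 : ENNReal.ofReal ((2 * r) ^ lam) * zygmundAvg f (closedBall x r) <
      ENNReal.ofReal N := by
    refine lt_of_le_of_lt ?_ h
    rw [← volume_closedBall_rpow hn lam x hr, zygmundMorreyNorm,
      iSup_cube_eq_iSup_closedBall fun Q => volume Q ^ (lam / (n : ℝ)) * zygmundAvg f Q]
    exact le_iSup_of_le x (le_iSup_of_le r (le_iSup_of_le hr le_rfl))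
  have h2 : zygmundAvg f (closedBall x r) < ENNReal.ofReal (N * (2 * r) ^ (-lam)) := by
    rw [Real.rpow_neg (by positivity), ← div_eq_mul_inv, ENNReal.ofReal_div_of_pos h2r,
      ENNReal.lt_div_iff_mul_lt (Or.inl (ENNReal.ofReal_pos.2 h2r).ne')
        (Or.inl ENNReal.ofReal_ne_top), mul_comm]
    exact h1
  simp only [zygmundAvg, iInf_lt_iff] at h2
  obtain ⟨α, hα, hmod, hlt⟩ := h2
  have hlt' : α < N * (2 * r) ^ (-lam) := (ENNReal.ofReal_lt_ofReal_iff (by positivity)).1 hlt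
  rw [mul_comm, ← div_eq_mul_inv, ENNReal.div_le_iff (volume_closedBall_pos x hr).ne'
    (volume_closedBall_ne_top x r), one_mul] at hmod
  refine le_trans (lintegral_mono fun z => ENNReal.ofReal_le_ofReal ?_) hmod
  refine zygmundFun_mono (t := |f z| / α) (by positivity) ?_
  gcongr

/-- A weak L¹ Morrey bound is enough, because the logarithmic factor in the weak average only
enlarges the admissible distribution function. -/
theorem weakZygmundMorreyNorm_le {n : ℕ} (hn : n ≠ 0) {lam K : ℝ} (hK : 0 < K)
    {g : (Fin n → ℝ) → ℝ}
    (h : ∀ (x : Fin n → ℝ) (r s : ℝ), 0 < r → 0 < s → volume {y ∈ closedBall x r | s < |g y|} ≤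
      ENNReal.ofReal (K * (2 * r) ^ (-lam) / s) * volume (closedBall x r)) :
    weakZygmundMorreyNorm lam g ≤ ENNReal.ofReal K := by
  rw [weakZygmundMorreyNorm,
    iSup_cube_eq_iSup_closedBall fun Q => volume Q ^ (lam / (n : ℝ)) * weakZygmundAvg g Q]
  refine iSup_le fun x => iSup_le fun r => iSup_le fun hr => ?_
  set α := K * (2 * r) ^ (-lam) with hα
  have hα0 : 0 < α := by positivity
  have h1 : weakZygmundAvg g (closedBall x r) ≤ ENNReal.ofReal α := by
    refine iInf_le_of_le α (iInf_le_of_le hα0 (iInf_le_of_le ?_ le_rfl))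
    refine iSup_le fun t => iSup_le fun ht => ?_
    have hw : 1 / t ≤ 1 / t * (1 + Real.posLog (1 / t)) :=
      le_mul_of_one_le_right (by positivity) (by linarith [Real.posLog_nonneg (x := 1 / t)])
    have hw0 : 0 < 1 / t * (1 + Real.posLog (1 / t)) := lt_of_lt_of_le (by positivity) hw
    rw [mul_comm, ← div_eq_mul_inv, ENNReal.div_le_iff (volume_closedBall_pos x hr).ne'
      (volume_closedBall_ne_top x r), one_mul, ENNReal.div_le_iff
      (ENNReal.ofReal_pos.2 hw0).ne' ENNReal.ofReal_ne_top, mul_comm (volume (closedBall x r))]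
    refine (h x r (α * t) hr (by positivity)).trans ?_
    gcongr
    rw [← hα, show α / (α * t) = 1 / t by field_simp]
    exact hw
  rw [volume_closedBall_rpow hn lam x hr]
  refine (mul_le_mul_right h1 _).trans (le_of_eq ?_)
  rw [← ENNReal.ofReal_mul (by positivity), hα, Real.rpow_neg (by positivity)]
  congr 1
  have : 0 < (2 * r) ^ lam := by positivity
  field_simp

/-! ### Finiteness almost everywhere and pointwise domination -/

/-- A function that satisfies a local weak type estimate is finite almost everywhere. -/
theorem ae_lt_top_of_volume_le {n : ℕ} {F : (Fin n → ℝ) → ℝ≥0∞} {K : ℝ → ℝ}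
    (h : ∀ r s : ℝ, 0 < r → 0 < s →
      volume {x ∈ closedBall (0 : Fin n → ℝ) r | ENNReal.ofReal s < F x} ≤
        ENNReal.ofReal (K r / s) * volume (closedBall (0 : Fin n → ℝ) r)) :
    ∀ᵐ x, F x < ∞ := by
  have hk : ∀ k : ℕ, volume {x ∈ closedBall (0 : Fin n → ℝ) ((k : ℝ) + 1) | F x = ∞} = 0 := by
    intro k
    -- The set where `F` is infinite lies in every superlevel set, so letting s → ∞ shows it is null
    -- in each ball.
    have hlim : Tendsto (fun s : ℝ => ENNReal.ofReal (K (k + 1) / s) *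
        volume (closedBall (0 : Fin n → ℝ) ((k : ℝ) + 1))) atTop (𝓝 0) := by
      have h1 : Tendsto (fun s : ℝ => ENNReal.ofReal (K (k + 1) / s)) atTop (𝓝 0) := by
        rw [← ENNReal.ofReal_zero]
        exact ENNReal.tendsto_ofReal (tendsto_id.const_div_atTop _)
      simpa using ENNReal.Tendsto.mul_const h1 (Or.inr (volume_closedBall_ne_top _ _))
    refine le_antisymm (ge_of_tendsto hlim ?_) bot_le
    filter_upwards [eventually_gt_atTop 0] with s hs
    refine (measure_mono fun x hx => ?_).trans (h (k + 1) s (by positivity) hs)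
    exact ⟨hx.1, by rw [hx.2]; exact ENNReal.ofReal_lt_top⟩
  refine measure_mono_null (fun x hx => ?_) (measure_iUnion_null hk)
  obtain ⟨k, hk⟩ := exists_nat_ge (dist x 0)
  refine mem_iUnion.2 ⟨k, mem_closedBall.2 (by linarith), ?_⟩
  simpa using hx

/-- The maximal commutator `sup_{B ∋ x} |B|⁻¹ ∫_B |p x - p z| |f z| dz`. -/
noncomputable def oscillationMaximal {n : ℕ} (p f : (Fin n → ℝ) → ℝ) (x : Fin n → ℝ) : ℝ≥0∞ :=
  supMean (fun z => ‖p x - p z‖ₑ * ‖f z‖ₑ) x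

/-- Pointwise in z, |b(z)| ≤ b⁺(z) + B ≤ |b⁺(x) - b⁺(z)| + b⁺(x) + B; multiply by |f(z)| and take
suprema of means. -/
theorem maximal_mul_le {n : ℕ} {b f : (Fin n → ℝ) → ℝ} (hb : AEMeasurable b)
    (hf : AEMeasurable f) {B : ℝ} (hB : 0 ≤ B) (hq : ∀ᵐ z, |min (b z) 0| ≤ B) (x : Fin n → ℝ) :
    maximal (fun y => b y * f y) x ≤ oscillationMaximal (fun y => max (b y) 0) f x +
      ENNReal.ofReal (max (b x) 0 + B) * maximal f x := by
  rw [maximal_eq_supMean, maximal_eq_supMean, ← supMean_const_mul _ ENNReal.ofReal_ne_top]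
  have hmeas : AEMeasurable fun z => ‖max (b x) 0 - max (b z) 0‖ₑ * ‖f z‖ₑ :=
    (((hb.max aemeasurable_const).const_sub _).enorm).mul hf.enorm
  refine (supMean_mono_ae ?_ x).trans (supMean_add_le hmeas x)
  filter_upwards [hq] with z hz
  rw [enorm_mul, ← add_mul]
  gcongr
  rw [Real.enorm_eq_ofReal_abs, Real.enorm_eq_ofReal_abs,
    ← ENNReal.ofReal_add (abs_nonneg _) (by positivity)]
  refine ENNReal.ofReal_le_ofReal ?_
  have h1 := neg_abs_le (max (b x) 0 - max (b z) 0)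
  have h2 := max_add_min (b z) 0
  have h3 := le_max_right (b z) 0
  have h4 := min_le_right (b z) 0
  rw [abs_of_nonpos h4] at hz
  rw [abs_le]
  constructor <;> linarith [le_max_right (b x) 0, abs_nonneg (max (b x) 0 - max (b z) 0)]

/-- The reverse direction: b⁺(x) ≤ |b⁺(x) - b⁺(z)| + B + |b(z)|. It is stated additively because no
subtraction is safe before finiteness is known. -/
theorem max_mul_maximal_le {n : ℕ} {b f : (Fin n → ℝ) → ℝ} (hb : AEMeasurable b)
    (hf : AEMeasurable f) {B : ℝ} (hB : 0 ≤ B) (hq : ∀ᵐ z, |min (b z) 0| ≤ B) (x : Fin n → ℝ) :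
    ENNReal.ofReal (max (b x) 0) * maximal f x ≤ oscillationMaximal (fun y => max (b y) 0) f x +
      (ENNReal.ofReal B * maximal f x + maximal (fun y => b y * f y) x) := by
  simp only [maximal_eq_supMean]
  rw [← supMean_const_mul _ ENNReal.ofReal_ne_top, ← supMean_const_mul _ ENNReal.ofReal_ne_top]
  have hmeas : AEMeasurable fun z => ‖max (b x) 0 - max (b z) 0‖ₑ * ‖f z‖ₑ :=
    (((hb.max aemeasurable_const).const_sub _).enorm).mul hf.enorm
  refine (supMean_mono_ae ?_ x).trans ((supMean_add_le hmeas x).trans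
    (add_le_add_right (supMean_add_le (hf.enorm.const_mul _) x) _))
  filter_upwards [hq] with z hz
  rw [enorm_mul, ← add_mul, ← add_mul]
  gcongr
  rw [Real.enorm_eq_ofReal_abs, Real.enorm_eq_ofReal_abs,
    ← ENNReal.ofReal_add hB (abs_nonneg _), ← ENNReal.ofReal_add (abs_nonneg _) (by positivity)]
  refine ENNReal.ofReal_le_ofReal ?_
  have h1 := le_abs_self (max (b x) 0 - max (b z) 0)
  have h2 := max_add_min (b z) 0
  have h3 := neg_abs_le (min (b z) 0)
  linarith [le_abs_self (b z)]

/-- The commutator is dominated by the maximal commutator of `b⁺` and the maximal function. -/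
theorem abs_maximalCommutator_le {n : ℕ} {b f : (Fin n → ℝ) → ℝ} (hb : AEMeasurable b)
    (hf : AEMeasurable f) {B : ℝ} (hB : 0 ≤ B) (hq : ∀ᵐ z, |min (b z) 0| ≤ B) {x : Fin n → ℝ}
    (hx : |min (b x) 0| ≤ B) (hM : maximal f x < ∞)
    (hO : oscillationMaximal (fun y => max (b y) 0) f x < ∞) :
    |maximalCommutator b f x| ≤ (oscillationMaximal (fun y => max (b y) 0) f x).toReal +
      2 * B * (maximal f x).toReal := by
  have h1 := maximal_mul_le hb hf hB hq x
  have h2 := max_mul_maximal_le hb hf hB hq x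
  have hbM : maximal (fun y => b y * f y) x < ∞ :=
    h1.trans_lt (ENNReal.add_lt_top.2 ⟨hO, ENNReal.mul_lt_top ENNReal.ofReal_lt_top hM⟩)
  unfold maximalCommutator
  lift maximal f x to ℝ≥0 using hM.ne with M
  lift maximal (fun y => b y * f y) x to ℝ≥0 using hbM.ne with L
  lift oscillationMaximal (fun y => max (b y) 0) f x to ℝ≥0 using hO.ne with O
  have hp := le_max_right (b x) 0
  have h1' := ENNReal.toReal_mono (by finiteness) h1
  have h2' := ENNReal.toReal_mono (by finiteness) h2
  rw [ENNReal.toReal_add (by finiteness) (by finiteness), ENNReal.toReal_mul,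
    ENNReal.toReal_ofReal (by positivity)] at h1'
  rw [ENNReal.toReal_add (by finiteness) (by finiteness), ENNReal.toReal_add (by finiteness)
    (by finiteness), ENNReal.toReal_mul, ENNReal.toReal_mul, ENNReal.toReal_ofReal hp,
    ENNReal.toReal_ofReal hB] at h2'
  simp only [ENNReal.coe_toReal] at h1' h2' ⊢
  have hM0 : (0 : ℝ) ≤ M := M.2
  have h3 := max_add_min (b x) 0
  have h4 := min_le_right (b x) 0
  rw [abs_of_nonpos h4] at hx
  have h5 : b x = max (b x) 0 + min (b x) 0 := by linarith
  have h6 : 0 ≤ -min (b x) 0 * M := mul_nonneg (by linarith) hM0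
  have h7 : -min (b x) 0 * M ≤ B * M := by gcongr
  rw [h5, abs_le]
  constructor <;> nlinarith

/-! ### Weak type estimates and the conclusion -/

theorem HasMorreyBound.volume_lt_maximal_le {n : ℕ} {lam N : ℝ} {f : (Fin n → ℝ) → ℝ}
    (hlam : 0 < lam) (hf : HasMorreyBound lam N f) (hN : 0 < N) (x₀ : Fin n → ℝ) {ρ s : ℝ}
    (hρ : 0 < ρ) (hs : 0 < s) :
    volume {x ∈ closedBall x₀ ρ | ENNReal.ofReal s < maximal f x} ≤
      ENNReal.ofReal ((1 + 5 ^ n * 3 ^ n) * (N * (2 * ρ) ^ (-lam)) / s) *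
        volume (closedBall x₀ ρ) := by
  simp only [maximal_eq_supMean, lt_supMean_iff]
  exact hf.volume_maximal_le hlam hN x₀ hρ hs

/-- Homogeneity in the symbol: the normalised estimate is applied to `B⁻¹ * p` at level `s / B`. -/
theorem exists_volume_lt_oscillationMaximal_le (n : ℕ) {lam : ℝ} (hlam : 0 < lam) :
    ∃ C : ℝ, 0 < C ∧ ∀ p f : (Fin n → ℝ) → ℝ, ∀ B N : ℝ, LocallyIntegrable p → 0 < B →
      bmoNorm p ≤ ENNReal.ofReal B → AEMeasurable f → 0 < N → HasMorreyBound lam N f →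
      ∀ (x₀ : Fin n → ℝ) (ρ s : ℝ), 0 < ρ → 0 < s →
      volume {x ∈ closedBall x₀ ρ | ENNReal.ofReal s < oscillationMaximal p f x} ≤
      ENNReal.ofReal (C * B * (N * (2 * ρ) ^ (-lam)) / s) * volume (closedBall x₀ ρ) := by
  obtain ⟨C, hC, h⟩ := exists_volume_maximalCommutator_le n hlam
  refine ⟨C, hC, fun p f B N hp hB hpB hfm hN hf x₀ ρ s hρ hs => ?_⟩
  have h1 := h _ f N (hasUnitOscillation_inv_mul hp hB hpB) hfm hN hf x₀ ρ (s / B) hρ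
    (by positivity)
  rw [show C * (N * (2 * ρ) ^ (-lam)) / (s / B) = C * B * (N * (2 * ρ) ^ (-lam)) / s by
    field_simp] at h1
  refine (measure_mono ?_).trans h1
  rintro x ⟨hx, hlt⟩
  obtain ⟨y, r, hr, hy, hlt⟩ := lt_supMean_iff.1 hlt
  refine ⟨hx, y, r, hr, hy, ?_⟩
  have h2 : ∀ z, ‖B⁻¹ * p x - B⁻¹ * p z‖ₑ * ‖f z‖ₑ =
      ENNReal.ofReal B⁻¹ * (‖p x - p z‖ₑ * ‖f z‖ₑ) := by
    intro z
    rw [← mul_sub, enorm_mul, Real.enorm_eq_ofReal (inv_pos.2 hB).le, mul_assoc]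
  simp_rw [h2]
  rw [lintegral_const_mul' _ _ ENNReal.ofReal_ne_top, div_eq_inv_mul,
    ENNReal.ofReal_mul (by positivity), mul_assoc]
  exact ENNReal.mul_lt_mul_right (by simpa using hB) ENNReal.ofReal_ne_top hlt

/-- The weak type estimate for the commutator, for upper bounds of the norms involved. -/
theorem exists_weakZygmundMorreyNorm_maximalCommutator_le {n : ℕ} (hn : n ≠ 0) {lam : ℝ}
    (hlam : 0 < lam) :
    ∃ c : ℝ, 0 < c ∧ ∀ b f : (Fin n → ℝ) → ℝ, ∀ B₁ B₂ N : ℝ, AEMeasurable b →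
      LocallyIntegrable (fun x => max (b x) 0) → 0 < B₁ →
      bmoNorm (fun x => max (b x) 0) ≤ ENNReal.ofReal B₁ → 0 < B₂ →
      (∀ᵐ z, |min (b z) 0| ≤ B₂) → AEMeasurable f → 0 < N → HasMorreyBound lam N f →
      (∀ᵐ x, maximal f x < ∞ ∧ maximal (fun y => b y * f y) x < ∞) ∧
      weakZygmundMorreyNorm lam (maximalCommutator b f) ≤
        ENNReal.ofReal (c * (B₁ + B₂) * N) := by
  obtain ⟨C, hC, hosc⟩ := exists_volume_lt_oscillationMaximal_le n hlam
  refine ⟨2 * C + 4 * (1 + 5 ^ n * 3 ^ n), by positivity, ?_⟩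
  intro b f B₁ B₂ N hbm hp hB₁ hpB hB₂ hq hfm hN hf
  have hO := hosc _ f B₁ N hp hB₁ hpB hfm hN hf
  have hMfin : ∀ᵐ x, maximal f x < ∞ :=
    ae_lt_top_of_volume_le fun r s hr hs => hf.volume_lt_maximal_le hlam hN 0 hr hs
  have hOfin : ∀ᵐ x, oscillationMaximal (fun y => max (b y) 0) f x < ∞ :=
    ae_lt_top_of_volume_le fun r s hr hs => hO 0 r s hr hs
  refine ⟨?_, ?_⟩
  · filter_upwards [hMfin, hOfin] with x hM hOx
    exact ⟨hM, (maximal_mul_le hbm hfm hB₂.le hq x).trans_lt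
      (ENNReal.add_lt_top.2 ⟨hOx, ENNReal.mul_lt_top ENNReal.ofReal_lt_top hM⟩)⟩
  refine weakZygmundMorreyNorm_le hn (by positivity) fun x₀ ρ s hρ hs => ?_
  -- Half of `s` is allotted to each term of the domination; the term 2 B₂ Mf exceeds s/2 exactly
  -- when Mf exceeds s/(4 B₂).
  have hM1 := hf.volume_lt_maximal_le hlam hN x₀ hρ (s := s / (4 * B₂)) (by positivity)
  refine (measure_mono_ae (?_ : _ ≤ᵐ[volume] _)).trans ((measure_union_le _ _).trans
    ((add_le_add (hO x₀ ρ (s / 2) hρ (by positivity)) hM1).trans ?_))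
  · filter_upwards [hMfin, hOfin, hq] with x hM hOx hqx
    rintro ⟨hx, hlt⟩
    have hle := hlt.trans_le (abs_maximalCommutator_le hbm hfm hB₂.le hq hqx hM hOx)
    by_cases hcase : s / 2 < (oscillationMaximal (fun y => max (b y) 0) f x).toReal
    · exact Or.inl ⟨hx, (ENNReal.ofReal_lt_iff_lt_toReal (by positivity) hOx.ne).2 hcase⟩
    · refine Or.inr ⟨hx, (ENNReal.ofReal_lt_iff_lt_toReal (by positivity) hM.ne).2 ?_⟩
      rw [div_lt_iff₀ (by positivity)]
      linarith
  · rw [← add_mul, ← ENNReal.ofReal_add (by positivity) (by positivity)]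
    gcongr
    rw [le_div_iff₀ hs]
    set α := (2 * ρ) ^ (-lam)
    have h1 : (C * B₁ * (N * α) / (s / 2) + (1 + 5 ^ n * 3 ^ n) * (N * α) / (s / (4 * B₂))) * s =
        (2 * C * B₁ + 4 * (1 + 5 ^ n * 3 ^ n) * B₂) * N * α := by
      field_simp
    rw [h1]
    gcongr
    have h2 : (0 : ℝ) ≤ 2 * C * B₂ + 4 * (1 + 5 ^ n * 3 ^ n) * B₁ := by positivity
    linarith

end ZygmundMorrey

theorem mainTheorem2 (n : ℕ) (lam : ℝ) (hlam : 0 < lam) (hlam_lt : lam < (n : ℝ)) :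
    ∃ c : ℝ≥0, 0 < c ∧
      ∀ b : (Fin n → ℝ) → ℝ, ZygmundMorrey.MemBMO b →
        MemLp (fun x => -min (b x) 0) ∞ volume →
        ∀ f : (Fin n → ℝ) → ℝ, ZygmundMorrey.MemZygmundMorrey lam f →
          (∀ᵐ x ∂(volume : Measure (Fin n → ℝ)),
            ZygmundMorrey.maximal f x < ∞ ∧
              ZygmundMorrey.maximal (fun y => b y * f y) x < ∞) ∧
          ZygmundMorrey.MemWeakZygmundMorrey lam (ZygmundMorrey.maximalCommutator b f) ∧
          ZygmundMorrey.weakZygmundMorreyNorm lam (ZygmundMorrey.maximalCommutator b f) ≤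
            (c : ℝ≥0∞) *
              (ZygmundMorrey.bmoNorm (fun x => max (b x) 0) +
                eLpNorm (fun x => -min (b x) 0) ∞ volume) *
              ZygmundMorrey.zygmundMorreyNorm lam f := by
  have hn : n ≠ 0 := by
    rintro rfl
    rw [Nat.cast_zero] at hlam_lt
    exact hlam.not_gt hlam_lt
  obtain ⟨c, hc, h⟩ :=
    ZygmundMorrey.exists_weakZygmundMorreyNorm_maximalCommutator_le hn hlam
  lift c to ℝ≥0 using hc.le
  refine ⟨c, hc, fun b hb hq f hf => ?_⟩
  have hbm : AEMeasurable b := hb.1.aestronglyMeasurable.aemeasurable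
  obtain ⟨hpfin, hploc⟩ := ZygmundMorrey.bmoNorm_max_zero_lt_top hb
  have hae : ∀ᵐ z, ‖-min (b z) 0‖ₑ ≤ eLpNorm (fun x => -min (b x) 0) ∞ volume := by
    rw [eLpNorm_exponent_top]
    exact ae_le_eLpNormEssSup
  have hqfin : eLpNorm (fun x => -min (b x) 0) ∞ volume < ∞ := hq.2
  have hN := hf.2
  generalize hP : ZygmundMorrey.bmoNorm (fun x => max (b x) 0) = P at hpfin ⊢
  generalize eLpNorm (fun x => -min (b x) 0) ∞ volume = q at hae hqfin ⊢
  generalize hZ : ZygmundMorrey.zygmundMorreyNorm lam f = Z at hN ⊢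
  lift P to ℝ≥0 using hpfin.ne
  lift q to ℝ≥0 using hqfin.ne
  lift Z to ℝ≥0 using hN.ne
  -- Inflating the three norms by `ε` makes the bounds positive even when a norm vanishes, and makes
  -- the Morrey inequality strict; ε → 0 recovers the sharp product.
  have key : ∀ ε : ℝ, 0 < ε → _ := fun ε hε => h b f (P + ε) (q + ε) (Z + ε) hbm hploc
    (by positivity) (by
      rw [hP, ← ENNReal.ofReal_coe_nnreal]
      exact ENNReal.ofReal_le_ofReal (by linarith)) (by positivity) (by
      filter_upwards [hae] with z hz
      rw [enorm_neg, Real.enorm_eq_ofReal_abs, ← ENNReal.ofReal_coe_nnreal,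
        ENNReal.ofReal_le_ofReal_iff q.coe_nonneg] at hz
      linarith) hf.1 (by positivity) (by
      refine ZygmundMorrey.hasMorreyBound_of_zygmundMorreyNorm_lt hn ?_
      rw [hZ, ← ENNReal.ofReal_coe_nnreal, ENNReal.ofReal_lt_ofReal_iff_of_nonneg Z.coe_nonneg]
      linarith)
  have hbound : ZygmundMorrey.weakZygmundMorreyNorm lam (ZygmundMorrey.maximalCommutator b f) ≤
      (c : ℝ≥0∞) * (P + q) * Z := by
    have hlim : Filter.Tendsto (fun ε : ℝ => ENNReal.ofReal (c * ((P + ε) + (q + ε)) * (Z + ε)))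
        (nhdsWithin 0 (Set.Ioi 0)) (nhds (ENNReal.ofReal (c * ((P + 0) + (q + 0)) * (Z + 0)))) :=
      ((ENNReal.continuous_ofReal.comp (by fun_prop :
        Continuous fun ε : ℝ => c * ((P + ε) + (q + ε)) * (Z + ε))).tendsto 0).mono_left
        nhdsWithin_le_nhds
    refine (ge_of_tendsto hlim ?_).trans (le_of_eq ?_)
    · filter_upwards [self_mem_nhdsWithin] with ε hε
      exact (key ε hε).2
    · rw [add_zero, add_zero, add_zero, ENNReal.ofReal_mul (by positivity),
        ENNReal.ofReal_mul hc.le, ENNReal.ofReal_add P.coe_nonneg q.coe_nonneg, ENNReal.ofReal_coe_nnreal,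
        ENNReal.ofReal_coe_nnreal, ENNReal.ofReal_coe_nnreal, ENNReal.ofReal_coe_nnreal]
  refine ⟨(key 1 one_pos).1, ⟨ZygmundMorrey.aemeasurable_maximalCommutator hbm f,
    hbound.trans_lt ?_⟩, hbound⟩
  exact ENNReal.mul_lt_top (ENNReal.mul_lt_top ENNReal.coe_lt_top
    (ENNReal.add_lt_top.2 ⟨ENNReal.coe_lt_top, ENNReal.coe_lt_top⟩)) ENNReal.coe_lt_top
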